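/- Let $\Phi$ be an irreducible reduced crystallographic root system (the root system of a connected simple complex algebraic group) with simple roots $\Pi$, positive roots $\Phi^+$, Weyl group $W$, coroot lattice $Q^\vee$, highest root $\theta$ and Coxeter number $h$. For an integer $t = ah + c$ with $0 \le c < h$ let $D^t$ be the set of $\lambda \in Q^\vee$ such that $\langle \alpha,\lambda\rangle \le a$ for all roots $\alpha$ of height $c$ and $\langle \alpha,\lambda\rangle \le a+1$ for all roots $\alpha$ of height $c-h$. Let $W_a = W \ltimes Q^\vee$ be the affine Weyl group, where $\tau_\lambda$ denotes translation by $\lambda \in Q^\vee$, with its length function with respect to the simple reflections $s_\alpha$ ($\alpha\in\Pi$) and $s_0 = s_\theta\tau_{-\theta^\vee}$. It acts on the affine roots $\alpha + m\delta$ ($\alpha\in\Phi$, $m\in\mathbb Z$) by $x\tau_\lambda(\alpha+m\delta) = x(\alpha) + (m+\langle\alpha,\lambda\rangle)\delta$ for $x \in W$; the affine root $\alpha+m\delta$ is positive if $\alpha\in\Phi^+$ and $m>0$, or $-\alpha\in\Phi^+$ and $m\ge 0$, and negative otherwise. For $w\in W_a$ let $\mathrm{supp}(w)$ be the set of $\alpha\in\Phi$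 such that, for some $m$, $\alpha+m\delta$ is positive and $w^{-1}(\alpha+m\delta)$ is negative. An ideal is a subset $\mathcal I\subseteq\Phi^+$ such that $\alpha\in\mathcal I$, $\beta\in\Phi^+$ and $\alpha+\beta\in\Phi^+$ imply $\alpha+\beta\in\mathcal I$; it is strictly positive if $\mathcal I\cap\Pi=\emptyset$. Put $ST(\mathcal I)=\{w\in W_a : \mathrm{supp}(w)=\mathcal I\}$. Then $$D^{h-1} = \{\lambda\in Q^\vee : \langle\theta,\lambda\rangle\le 0 \text{ and } \langle-\alpha,\lambda\rangle\le 1 \text{ for all } \alpha\in\Pi\};$$ for every strictly positive ideal $\mathcal I$ the set $ST(\mathcal I)$ has a unique element $w_{\mathcal I,\max}$ of maximal length; and the map sending $\mathcal I$ to the translation part $\lambda$ of $w_{\mathcal I,\max} = x\tau_\lambda$ ($x\in W$, $\lambda\in Q^\vee$) is a bijection from the set of strictly positive ideals onto $D^{h-1}$. -/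

import Mathlib

namespace AffineWeyl

open RootPairing

noncomputable section

section Group

variable {ι M N : Type*} [AddCommGroup M] [Module ℝ M] [AddCommGroup N] [Module ℝ N]

/-- The coroot lattice `Q^∨`, inside the space `V = N` of the root system. -/
abbrev CorootLattice (P : RootPairing ι ℝ M N) : Submodule ℤ N := P.corootSpan ℤ

/-- An automorphism of the root system maps the coroot lattice to itself. (In Mathlib, automorphisms
act on the coroot space from the right: `MulOpposite.op g • v` is `g⁻¹ v`.) -/
lemma op_smul_mem_corootLattice (P : RootPairing ι ℝ M N) (g : P.Aut) {v : N}
    (hv : v ∈ CorootLattice P) : MulOpposite.op g • v ∈ CorootLattice P := by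
  induction hv using Submodule.span_induction with
  | mem v hv =>
    obtain ⟨i, rfl⟩ := hv
    have h : MulOpposite.op g • P.coroot i = P.coroot (g.indexEquiv.symm i) :=
      Hom.coroot_coweightMap_apply (P := P) (Q := P) i g.toHom
    rw [h]
    exact Submodule.subset_span (Set.mem_range_self _)
  | zero => simp
  | add v w _ _ hv hw => rw [smul_add]; exact add_mem hv hw
  | smul n v _ hv =>
    have h : MulOpposite.op g • (n • v) = n • (MulOpposite.op g • v) :=
      map_zsmul (DistribSMul.toAddMonoidHom N (MulOpposite.op g)) n v
    rw [h]
    exact Submodule.smul_mem _ n hv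

/-- The usual (left) action of the Weyl group on the coroot lattice: `x • λ = x(λ)`. -/
instance weylAction (P : RootPairing ι ℝ M N) :
    DistribMulAction P.weylGroup (CorootLattice P) where
  smul x l := ⟨MulOpposite.op (x : P.Aut)⁻¹ • (l : N),
    op_smul_mem_corootLattice P (x : P.Aut)⁻¹ l.2⟩
  one_smul l := Subtype.ext (by
    change MulOpposite.op ((1 : P.weylGroup) : P.Aut)⁻¹ • (l : N) = l
    simp)
  mul_smul x y l := Subtype.ext (by
    change MulOpposite.op ((x * y : P.weylGroup) : P.Aut)⁻¹ • (l : N) =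
      MulOpposite.op (x : P.Aut)⁻¹ • (MulOpposite.op (y : P.Aut)⁻¹ • (l : N))
    rw [smul_smul, ← MulOpposite.op_mul, Subgroup.coe_mul, mul_inv_rev])
  smul_zero x := Subtype.ext (smul_zero (MulOpposite.op (x : P.Aut)⁻¹))
  smul_add x l m :=
    Subtype.ext (smul_add (MulOpposite.op (x : P.Aut)⁻¹) (l : N) (m : N))

/-- The same action, as automorphisms of the lattice written multiplicatively. -/
def weylHom (P : RootPairing ι ℝ M N) :
    P.weylGroup →* MulAut (Multiplicative (CorootLattice P)) where
  toFun x := AddEquiv.toMultiplicative (DistribMulAction.toAddEquiv (CorootLattice P) x)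
  map_one' := MulEquiv.ext fun l ↦ by
    change Multiplicative.ofAdd ((1 : P.weylGroup) • l.toAdd) = l
    rw [one_smul]; rfl
  map_mul' x y := MulEquiv.ext fun l ↦ by
    change Multiplicative.ofAdd ((x * y) • l.toAdd) = Multiplicative.ofAdd (x • (y • l.toAdd))
    rw [mul_smul]

/-- The affine Weyl group `W_a = W ⋉ Q^∨`. -/
abbrev AffineWeylGroup (P : RootPairing ι ℝ M N) : Type _ :=
  Multiplicative (CorootLattice P) ⋊[weylHom P] P.weylGroup

/-- The inclusion of the finite Weyl group `W` in `W_a`. -/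
def ofWeyl (P : RootPairing ι ℝ M N) (x : P.weylGroup) : AffineWeylGroup P :=
  SemidirectProduct.inr x

/-- The translation `τ_λ` in `W_a`. -/
def tau (P : RootPairing ι ℝ M N) (l : CorootLattice P) : AffineWeylGroup P :=
  SemidirectProduct.inl (Multiplicative.ofAdd l)

/-- The finite part `x` of `w = x τ_λ`. -/
def finPart {P : RootPairing ι ℝ M N} (w : AffineWeylGroup P) : P.weylGroup := w.right

/-- The translation part `λ` of `w = x τ_λ`. -/
def transPart {P : RootPairing ι ℝ M N} (w : AffineWeylGroup P) : CorootLattice P :=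
  w.right⁻¹ • w.left.toAdd

lemma eq_ofWeyl_mul_tau {P : RootPairing ι ℝ M N} (w : AffineWeylGroup P) :
    w = ofWeyl P (finPart w) * tau P (transPart w) := by
  apply SemidirectProduct.ext
  · change w.left = 1 * Multiplicative.ofAdd (w.right • (w.right⁻¹ • w.left.toAdd))
    rw [smul_inv_smul, one_mul]; rfl
  · change w.right = w.right * 1
    rw [mul_one]

lemma finPart_ofWeyl_mul_tau (P : RootPairing ι ℝ M N) (x : P.weylGroup) (l : CorootLattice P) :
    finPart (ofWeyl P x * tau P l) = x :=
  mul_one x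

lemma transPart_ofWeyl_mul_tau (P : RootPairing ι ℝ M N) (x : P.weylGroup)
    (l : CorootLattice P) : transPart (ofWeyl P x * tau P l) = l := by
  have h : ((ofWeyl P x * tau P l).left.toAdd) = x • l := zero_add (x • l)
  have h' : (ofWeyl P x * tau P l).right = x := mul_one x
  rw [transPart, h, h', inv_smul_smul]

/-- The integer `⟨α, λ⟩`, for the root `α` with index `i` and `λ` in the coroot lattice. -/
def pair (P : RootPairing ι ℝ M N) [P.IsCrystallographic] (i : ι) (l : CorootLattice P) : ℤ :=
  P.root'In ℤ i l

lemma coe_pair (P : RootPairing ι ℝ M N) [P.IsCrystallographic] (i : ι) (l : CorootLattice P) :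
    (pair P i l : ℝ) = P.toLinearMap (P.root i) (l : N) :=
  P.algebraMap_root'In_apply ℤ i l

/-- The action on affine roots: `w (α + m δ) = x(α) + (m + ⟨α, λ⟩) δ` for `w = x τ_λ`.
The affine root `α + m δ` is represented by the pair of the index of `α` and `m`. -/
def affineRootAct (P : RootPairing ι ℝ M N) [P.IsCrystallographic] (w : AffineWeylGroup P)
    (a : ι × ℤ) : ι × ℤ :=
  (P.weylGroupToPerm (finPart w) a.1, a.2 + pair P a.1 (transPart w))

end Group

section Base

variable {ι M N : Type*} [AddCommGroup M] [Module ℝ M] [AddCommGroup N] [Module ℝ N]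
  {P : RootPairing ι ℝ M N} (b : P.Base)

/-- `θ` is the highest root: the root of greatest height. -/
def IsHighestRoot (θ : ι) : Prop := ∀ i, b.height i ≤ b.height θ

/-- The Coxeter number `h = ht(θ) + 1`, where `θ` is the highest root. -/
def coxeterNumber (θ : ι) : ℤ := b.height θ + 1

/-- An (upper order) ideal of the set `Φ⁺` of positive roots. -/
structure IsIdeal (I : Set ι) : Prop where
  isPos : ∀ i ∈ I, b.IsPos i
  add_mem : ∀ i ∈ I, ∀ j k, b.IsPos j → b.IsPos k → P.root k = P.root i + P.root j → k ∈ I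

/-- A strictly positive ideal: one that contains no simple root. -/
structure IsStrictlyPositiveIdeal (I : Set ι) : Prop extends IsIdeal b I where
  disjoint : Disjoint I (b.support : Set ι)

/-- The affine root `α + m δ` is positive if `α ∈ Φ⁺` and `m > 0`, or `-α ∈ Φ⁺` and `m ≥ 0`. -/
def IsPosAffine (a : ι × ℤ) : Prop :=
  (b.IsPos a.1 ∧ 0 < a.2) ∨ (b.IsPos (P.reflectionPerm a.1 a.1) ∧ 0 ≤ a.2)

/-- The simple reflections of `W_a`: the reflections in the simple roots, and
`s₀ = s_θ τ_{-θ^∨}`, where `θ` is the highest root. -/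
def simpleReflections (θ : ι) : Set (AffineWeylGroup P) :=
  insert (ofWeyl P (weylGroup.ofIdx P θ) * tau P (-P.corootSpanMem ℤ θ))
    ((fun i ↦ ofWeyl P (weylGroup.ofIdx P i)) '' (b.support : Set ι))

/-- The length of `w` in `W_a`: the least number of factors in an expression of `w` as a product
of simple reflections. -/
def length (θ : ι) (w : AffineWeylGroup P) : ℕ :=
  sInf {n | ∃ l : List (AffineWeylGroup P),
    l.length = n ∧ (∀ s ∈ l, s ∈ simpleReflections b θ) ∧ l.prod = w}

variable [P.IsCrystallographic]

/-- `N(w)`: the positive affine roots that `w⁻¹` makes negative. -/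
def invSet (w : AffineWeylGroup P) : Set (ι × ℤ) :=
  {a | IsPosAffine b a ∧ ¬ IsPosAffine b (affineRootAct P w⁻¹ a)}

/-- `supp(w)`: the roots `α` such that `α + m δ ∈ N(w)` for some `m`. -/
def supp (w : AffineWeylGroup P) : Set ι := {i | ∃ m : ℤ, (i, m) ∈ invSet b w}

/-- The sign type `ST(I)`: all `w` with `supp(w) = I`. -/
def signType (I : Set ι) : Set (AffineWeylGroup P) := {w | supp b w = I}

/-- `w` is an element of maximal length of `ST(I)`. -/
def IsMaxElement (θ : ι) (I : Set ι) (w : AffineWeylGroup P) : Prop :=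
  w ∈ signType b I ∧ ∀ w' ∈ signType b I, length b θ w' ≤ length b θ w

/-- With `t = a h + c`, `0 ≤ c < h`, the set `D^t` of all `λ ∈ Q^∨` such that `⟨α, λ⟩ ≤ a` for
the roots `α` of height `c` and `⟨α, λ⟩ ≤ a + 1` for the roots `α` of height `c - h`. -/
def latticePoints (h t : ℤ) : Set (CorootLattice P) :=
  {l | (∀ i, b.height i = t % h → pair P i l ≤ t / h) ∧
    (∀ i, b.height i = t % h - h → pair P i l ≤ t / h + 1)}

end Base

end

end AffineWeyl

namespace AffineWeyl

set_option linter.unusedSectionVars false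

open RootPairing

/-! ### Dominance, full support and uniqueness of the maximal root -/

section RootSystem

variable {ι M N : Type*} [AddCommGroup M] [Module ℝ M] [AddCommGroup N] [Module ℝ N]
  {P : RootPairing ι ℝ M N}

/-! Encode `w` by its address: `K α` is the least `m` for which `w⁻¹ (α + m δ)` is positive. The
fundamental address is `posInd`, and the simple affine roots are `θ + δ` and `-α_j + 0 δ`. An
address satisfies `K (-α) = 1 - K α` and is subadditive on sums that are roots. Conversely each such
function comes from exactly one `w` (`IsAddress.exists_word`, `address_injective`), and the length
of `w` is the sum of the positive parts of `K - posInd` (`length_eq_excess`).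

For an ideal `I` with complement `J` in the positive roots, `supp w = I` means that on positive
roots `K ≥ 1`, with `K ≥ 2` exactly on `I`. Hence `K ≤ 1` on `J`, and subadditivity bounds `K α` by
the least number of roots of `J` with sum `α`. This minimal number exists because `J` contains the
simple roots, and it extends to an address. The crux is the splitting lemma
`IsLowerRootSet.exists_split`: a decomposition of `α + β` over `J` can be rearranged into
decompositions of `α` and of `β` at the cost of one extra summand. So `ST(I)` has a pointwise
largest address, which gives the unique longest element.

For `w = x τ_λ` one has `K (x α) = posInd α + ⟨α, λ⟩`, so `λ` lies in the simplex `D^{h-1}` exactly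
when `K (x g) ≤ 1` for every simple affine root `g`. If the maximal `K` violated this, removing one
summand from a shortest decomposition of `x g` would write a simple affine root as a sum of two
positive affine roots.

Conversely every `λ` is the translation part of exactly one dominant `w`, meaning `K ≥ 1` on
positive roots. This uniqueness gives injectivity, since `I` is the support of `w`. If `λ` lies in
the simplex, no simple root is in the support (`address_le_one_of_mem_support`), and `w` is maximal:
pulled back by `w`, the maximal address does not exceed `posInd` at any simple affine root, which
forces it to be `posInd`. -/

lemma pairingIn_pos_iff_rootForm_pos [Fintype ι] [P.IsCrystallographic] (i j : ι) :
    0 < P.pairingIn ℤ i j ↔ 0 < P.RootForm (P.root i) (P.root j) := by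
  have h := (P.posRootForm ℝ).two_mul_apply_root_root i j
  change 2 * P.RootForm (P.root i) (P.root j) =
    P.pairing i j * P.RootForm (P.root j) (P.root j) at h
  have hj : 0 < P.RootForm (P.root j) (P.root j) :=
    P.rootForm_pos_of_ne_zero (Submodule.subset_span (Set.mem_range_self j)) (P.ne_zero j)
  rw [← P.algebraMap_pairingIn ℤ] at h
  have h2 : 0 < P.pairingIn ℤ i j ↔ 0 < (algebraMap ℤ ℝ (P.pairingIn ℤ i j)) := by simp
  rw [h2, ← mul_pos_iff_of_pos_right hj, ← h]
  simp

lemma rootForm_root_self_pos [Fintype ι] (j : ι) : 0 < P.RootForm (P.root j) (P.root j) :=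
  P.rootForm_pos_of_ne_zero (Submodule.subset_span (Set.mem_range_self j)) (P.ne_zero j)

lemma exists_root_eq_sub [Fintype ι] [P.IsCrystallographic] {i j : ι} (hij : i ≠ j)
    (h : 0 < P.RootForm (P.root i) (P.root j)) : ∃ k, P.root k = P.root i - P.root j :=
  P.root_sub_root_mem_of_pairingIn_pos ((pairingIn_pos_iff_rootForm_pos i j).2 h) hij

lemma root_opp (i : ι) : P.root (P.reflectionPerm i i) = -P.root i := by
  simp

lemma exists_root_eq_add [Fintype ι] [P.IsCrystallographic] {i j : ι}
    (hij : P.root i ≠ -P.root j)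
    (h : P.RootForm (P.root i) (P.root j) < 0) : ∃ k, P.root k = P.root i + P.root j := by
  have h1 : i ≠ P.reflectionPerm j j := fun h ↦ hij (by rw [h, root_opp])
  obtain ⟨k, hk⟩ := exists_root_eq_sub h1 (by rw [root_opp]; simpa using h)
  exact ⟨k, by rw [hk, root_opp, sub_neg_eq_add]⟩

lemma rootForm_comm [Fintype ι] (x y : M) : P.RootForm x y = P.RootForm y x :=
  (P.rootForm_symmetric.eq y x).symm

section Base

variable (b : P.Base)

lemma height_opp (i : ι) : b.height (P.reflectionPerm i i) = -b.height i :=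
  b.height_reflectionPerm_self i

lemma isPos_opp_iff (i : ι) : b.IsPos (P.reflectionPerm i i) ↔ ¬ b.IsPos i :=
  Base.IsPos.neg_iff_not b i

lemma opp_opp (i : ι) :
    P.reflectionPerm (P.reflectionPerm i i) (P.reflectionPerm i i) = i := by
  apply P.root.injective
  rw [root_opp, root_opp, neg_neg]

variable [Finite ι] [P.IsCrystallographic] [P.IsReduced]

lemma rootForm_nonneg_of_forall_support [Fintype ι] {x : M}
    (h : ∀ j ∈ b.support, 0 ≤ P.RootForm x (P.root j)) {i : ι} (hi : b.IsPos i) :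
    0 ≤ P.RootForm x (P.root i) := by
  refine hi.induction_on_add (p := fun i ↦ 0 ≤ P.RootForm x (P.root i)) h ?_
  intro i j k hk hi hj
  rw [hk, map_add]
  exact add_nonneg hi (h j hj)

/-- A positive root to which no simple root can be added is dominant. -/
lemma rootForm_nonneg_of_maximal [Fintype ι] {i : ι} (hi : b.IsPos i)
    (h : ∀ j ∈ b.support, ∀ k, P.root k ≠ P.root i + P.root j) {k : ι} (hk : b.IsPos k) :
    0 ≤ P.RootForm (P.root i) (P.root k) := by
  refine rootForm_nonneg_of_forall_support b (fun j hj ↦ ?_) hk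
  by_contra! hlt
  have hne : P.root i ≠ -P.root j := by
    intro h
    rw [← root_opp] at h
    rw [P.root.injective h] at hi
    exact (isPos_opp_iff b j).1 hi (Base.isPos_of_mem_support hj)
  obtain ⟨k, hk⟩ := exists_root_eq_add hne hlt
  exact h j hj k hk

/-- If no simple root can be added to a positive root, then no positive root can. -/
lemma add_ne_root_of_maximal {i : ι} (hi : b.IsPos i)
    (h : ∀ j ∈ b.support, ∀ k, P.root k ≠ P.root i + P.root j) {j : ι} (hj : b.IsPos j) (k : ι) :
    P.root k ≠ P.root i + P.root j := by
  cases nonempty_fintype ι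
  suffices b.IsPos j ∧ ∀ k, P.root k ≠ P.root i + P.root j from this.2 k
  refine hj.induction_on_add (p := fun j ↦ b.IsPos j ∧ ∀ k, P.root k ≠ P.root i + P.root j)
    (fun j hj ↦ ⟨Base.isPos_of_mem_support hj, h j hj⟩) ?_
  rintro c j γ hγ ⟨hc, hc'⟩ hj
  have hjp : b.IsPos j := Base.isPos_of_mem_support hj
  have hγp : b.IsPos γ := hc.add hjp hγ
  refine ⟨hγp, fun ρ hρ ↦ ?_⟩
  have hhρ := b.height_add hρ
  have hhγ := b.height_add hγ
  -- If `ρ` paired positively with `c`, then `ρ - c = i + j` would be a root; likewise `ρ - j = i +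
  -- c`. So `(ρ, γ) ≤ 0`, whereas `(ρ, γ) = (i, γ) + (γ, γ) > 0` by dominance of `i`.
  have h1 : P.RootForm (P.root ρ) (P.root c) ≤ 0 := by
    by_contra! hlt
    obtain ⟨k, hk⟩ := exists_root_eq_sub (fun e ↦ by
      subst e; rw [Base.isPos_iff] at *; omega) hlt
    exact h j hj k (by rw [hk, hρ, hγ]; abel)
  have h2 : P.RootForm (P.root ρ) (P.root j) ≤ 0 := by
    by_contra! hlt
    obtain ⟨k, hk⟩ := exists_root_eq_sub (fun e ↦ by
      subst e; rw [Base.isPos_iff] at *; omega) hlt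
    exact hc' k (by rw [hk, hρ, hγ]; abel)
  have h3 : P.RootForm (P.root ρ) (P.root γ) ≤ 0 := by
    rw [hγ, map_add]; linarith
  rw [hρ, map_add, LinearMap.add_apply] at h3
  have h4 := rootForm_nonneg_of_maximal b hi h hγp
  have h5 := rootForm_root_self_pos (P := P) γ
  linarith

variable [P.IsRootSystem]

/-- The coefficient of the simple root `j`. -/
noncomputable def coeff (j : b.support) : M →ₗ[ℝ] ℝ := b.toWeightBasis.coord j

lemma coeff_root_support [DecidableEq ι] (j : b.support) {i : ι} (hi : i ∈ b.support) :
    coeff b j (P.root i) = if i = j then 1 else 0 := by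
  have := b.toWeightBasis_repr_root ⟨i, hi⟩
  simp only [coeff, Module.Basis.coord_apply]
  simp only at this
  rw [this, Finsupp.single_apply]
  congr 1
  simp [Subtype.ext_iff]

lemma coeff_nonneg (j : b.support) {i : ι} (hi : b.IsPos i) : 0 ≤ coeff b j (P.root i) := by
  classical
  refine hi.induction_on_add (p := fun i ↦ 0 ≤ coeff b j (P.root i)) (fun i hi ↦ ?_) ?_
  · rw [coeff_root_support b j hi]; split_ifs <;> simp
  · intro i k l hl hi hk
    rw [hl, map_add, coeff_root_support b j hk]
    split_ifs <;> simp [hi, add_nonneg]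

lemma sum_coeff (x : M) : ∑ j : b.support, coeff b j x • P.root j = x := by
  have := b.toWeightBasis.sum_repr x
  simpa [coeff] using this

/-- A maximal positive root of an irreducible root system has full support. -/
lemma coeff_pos_of_maximal [P.IsIrreducible] {i : ι} (hi : b.IsPos i)
    (h : ∀ j ∈ b.support, ∀ k, P.root k ≠ P.root i + P.root j) (j : b.support) :
    0 < coeff b j (P.root i) := by
  classical
  cases nonempty_fintype ι
  let S : Set ι := {k | ∃ hk : k ∈ b.support, 0 < coeff b ⟨k, hk⟩ (P.root i)}
  let q : Submodule ℝ M := Submodule.span ℝ (P.root '' S)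
  -- For `k` outside the support of `i`, the pairing `(i, k) ≥ 0` is a sum of nonpositive terms, so
  -- each term vanishes. This makes `q` stable under all simple reflections, and irreducibility
  -- makes it everything.
  have key : ∀ k ∈ b.support, k ∉ S → ∀ l ∈ S, P.pairing l k = 0 := by
    intro k hk hkS l hl
    have hle : ∀ m : b.support,
        coeff b m (P.root i) * P.RootForm (P.root m) (P.root k) ≤ 0 := by
      intro m
      by_cases hmk : (m : ι) = k
      · have : coeff b m (P.root i) ≤ 0 := by
          by_contra! hlt
          exact hkS ⟨hk, by simpa [← hmk] using hlt⟩
        rw [le_antisymm this (coeff_nonneg b m hi), zero_mul]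
      · refine mul_nonpos_of_nonneg_of_nonpos (coeff_nonneg b m hi) ?_
        have := b.pairingIn_le_zero_of_ne hmk m.2 hk
        by_contra! hlt
        rw [← pairingIn_pos_iff_rootForm_pos] at hlt
        omega
    have hsum : ∑ m : b.support, coeff b m (P.root i) * P.RootForm (P.root m) (P.root k) =
        P.RootForm (P.root i) (P.root k) := by
      conv_rhs => rw [← sum_coeff b (P.root i)]
      simp [LinearMap.sum_apply]
    have h0 := rootForm_nonneg_of_maximal b hi h (Base.isPos_of_mem_support hk)
    have hz : ∑ m : b.support, coeff b m (P.root i) * P.RootForm (P.root m) (P.root k) = 0 :=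
      le_antisymm (Finset.sum_nonpos fun m _ ↦ hle m) (hsum ▸ h0)
    obtain ⟨hl', hl0⟩ := hl
    have := (Finset.sum_eq_zero_iff_of_nonpos (fun m _ ↦ hle m)).1 hz ⟨l, hl'⟩ (Finset.mem_univ _)
    have hB : P.RootForm (P.root l) (P.root k) = 0 := by
      rcases mul_eq_zero.1 this with h | h
      · exact absurd h hl0.ne'
      · exact h
    exact (P.toInvariantForm.apply_root_root_zero_iff l k).1 hB
  have hinv : ∀ k, q ∈ Module.End.invtSubmodule (P.reflection k) := by
    rw [← b.forall_mem_support_invtSubmodule_iff]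
    intro k hk
    rw [Module.End.mem_invtSubmodule]
    change Submodule.span ℝ (P.root '' S) ≤ _
    rw [Submodule.span_le]
    rintro - ⟨l, hl, rfl⟩
    change P.reflection k (P.root l) ∈ q
    rw [P.reflection_apply_root]
    by_cases hkS : k ∈ S
    · exact sub_mem (Submodule.subset_span ⟨l, hl, rfl⟩)
        (Submodule.smul_mem _ _ (Submodule.subset_span ⟨k, hkS, rfl⟩))
    · rw [key k hk hkS l hl, zero_smul, sub_zero]
      exact Submodule.subset_span ⟨l, hl, rfl⟩
  have hmem : P.root i ∈ q := by
    rw [← sum_coeff b (P.root i)]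
    refine Submodule.sum_mem _ fun m _ ↦ ?_
    rcases (coeff_nonneg b m hi).eq_or_lt with h0 | h0
    · rw [← h0, zero_smul]; exact zero_mem _
    · exact Submodule.smul_mem _ _ (Submodule.subset_span ⟨m, ⟨m.2, h0⟩, rfl⟩)
  have htop : q = ⊤ := by
    refine IsIrreducible.eq_top_of_invtSubmodule_reflection q hinv ?_
    intro hbot
    rw [hbot, Submodule.mem_bot] at hmem
    exact P.ne_zero i hmem
  by_contra hj
  have hjS : (j : ι) ∉ S := fun ⟨_, h⟩ ↦ hj h
  have hker : q ≤ LinearMap.ker (coeff b j) := by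
    change Submodule.span ℝ (P.root '' S) ≤ _
    rw [Submodule.span_le]
    rintro - ⟨l, hl, rfl⟩
    have : l ≠ j := fun e ↦ hjS (e ▸ hl)
    obtain ⟨hl', -⟩ := hl
    simp [coeff_root_support b j hl', this]
  have := hker (htop ▸ Submodule.mem_top : P.root j ∈ q)
  simp [coeff_root_support b j j.2] at this

/-- An irreducible root system has at most one maximal positive root. -/
lemma maximal_unique [P.IsIrreducible] {i i' : ι} (hi : b.IsPos i)
    (h : ∀ j ∈ b.support, ∀ k, P.root k ≠ P.root i + P.root j) (hi' : b.IsPos i')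
    (h' : ∀ j ∈ b.support, ∀ k, P.root k ≠ P.root i' + P.root j) : i = i' := by
  cases nonempty_fintype ι
  by_contra hne
  -- Both roots are dominant with full support, so they pair positively and their difference is a
  -- root. That difference or its opposite is positive, and adding it to one of the two roots gives
  -- the other, against maximality.
  have hpos : 0 < P.RootForm (P.root i) (P.root i') := by
    have hnn : ∀ j : b.support, 0 ≤ P.RootForm (P.root i) (P.root j) := fun j ↦
      rootForm_nonneg_of_maximal b hi h (Base.isPos_of_mem_support j.2)
    have hex : ∃ j : b.support, 0 < P.RootForm (P.root i) (P.root j) := by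
      by_contra! hall
      have h0 := rootForm_root_self_pos (P := P) i
      nth_rw 2 [← sum_coeff b (P.root i)] at h0
      rw [map_sum] at h0
      refine absurd h0 (not_lt.2 (Finset.sum_nonpos fun j _ ↦ ?_))
      rw [map_smul, smul_eq_mul]
      exact mul_nonpos_of_nonneg_of_nonpos (coeff_nonneg b j hi) (hall j)
    obtain ⟨j, hj⟩ := hex
    rw [← sum_coeff b (P.root i'), map_sum]
    refine Finset.sum_pos' (fun m _ ↦ ?_) ⟨j, Finset.mem_univ _, ?_⟩
    · rw [map_smul, smul_eq_mul]
      exact mul_nonneg (coeff_nonneg b m hi') (hnn m)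
    · rw [map_smul, smul_eq_mul]
      exact mul_pos (coeff_pos_of_maximal b hi' h' j) hj
  obtain ⟨k, hk⟩ := exists_root_eq_sub hne hpos
  by_cases hkp : b.IsPos k
  · exact add_ne_root_of_maximal b hi' h' hkp i (by rw [hk]; abel)
  · exact add_ne_root_of_maximal b hi h ((isPos_opp_iff b k).2 hkp) i' (by
      rw [root_opp, hk]; abel)

end Base

end RootSystem

/-! ### The highest root and simple affine reflections -/

section HighestRoot

variable {ι M N : Type*} [AddCommGroup M] [Module ℝ M] [AddCommGroup N] [Module ℝ N]
  {P : RootPairing ι ℝ M N} (b : P.Base) [Finite ι] [P.IsCrystallographic] [P.IsReduced]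
  [P.IsRootSystem] {θ : ι}

lemma IsHighestRoot.isPos {b : P.Base} (hθ : IsHighestRoot b θ) : b.IsPos θ := by
  have h := hθ (P.reflectionPerm θ θ)
  rw [height_opp] at h
  have := b.height_ne_zero θ
  rw [Base.isPos_iff]
  omega

lemma IsHighestRoot.add_ne_root {b : P.Base} (hθ : IsHighestRoot b θ) (j : ι) (hj : b.IsPos j)
    (k : ι) : P.root k ≠ P.root θ + P.root j := by
  intro h
  have h1 := b.height_add h
  have h2 := hθ k
  rw [Base.isPos_iff] at hj
  omega

lemma IsHighestRoot.maximal {b : P.Base} (hθ : IsHighestRoot b θ) :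
    ∀ j ∈ b.support, ∀ k, P.root k ≠ P.root θ + P.root j :=
  fun j hj k ↦ hθ.add_ne_root j (Base.isPos_of_mem_support hj) k

lemma IsHighestRoot.rootForm_nonneg [Fintype ι] {b : P.Base} (hθ : IsHighestRoot b θ) {i : ι}
    (hi : b.IsPos i) : 0 ≤ P.RootForm (P.root θ) (P.root i) :=
  rootForm_nonneg_of_maximal b hθ.isPos hθ.maximal hi

variable [P.IsIrreducible]

lemma IsHighestRoot.eq_of_height_eq {b : P.Base} (hθ : IsHighestRoot b θ) {i : ι}
    (h : b.height i = b.height θ) : i = θ := by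
  have hi : IsHighestRoot b i := fun j ↦ h ▸ hθ j
  exact maximal_unique b hi.isPos hi.maximal hθ.isPos hθ.maximal

lemma IsHighestRoot.height_lt {b : P.Base} (hθ : IsHighestRoot b θ) {i : ι}
    (h : i ≠ θ) : b.height i < b.height θ :=
  lt_of_le_of_ne (hθ i) fun e ↦ h (hθ.eq_of_height_eq e)

/-- Downward induction from the highest root along the root poset. -/
lemma IsHighestRoot.induction {b : P.Base} (hθ : IsHighestRoot b θ) {p : ι → Prop} (h0 : p θ)
    (h : ∀ i j k, b.IsPos i → j ∈ b.support → P.root k = P.root i + P.root j → p k → p i)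
    {i : ι} (hi : b.IsPos i) : p i := by
  generalize hn : (b.height θ - b.height i).toNat = n
  induction n using Nat.strong_induction_on generalizing i with
  | _ n ih =>
    by_cases hm : ∀ j ∈ b.support, ∀ k, P.root k ≠ P.root i + P.root j
    · rwa [maximal_unique b hi hm hθ.isPos hθ.maximal]
    · push Not at hm
      obtain ⟨j, hj, k, hk⟩ := hm
      have hkp := hi.add (Base.isPos_of_mem_support hj) hk
      have h1 := b.height_add hk
      rw [Base.height_one_of_mem_support hj] at h1
      have h2 := hθ k
      exact h i j k hi hj hk (ih _ (by omega) hkp rfl)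

open Classical in
/-- The indicator function of the positive roots. -/
noncomputable def posInd (b : P.Base) (i : ι) : ℤ := if b.IsPos i then 1 else 0

lemma posInd_of_isPos {b : P.Base} {i : ι} (h : b.IsPos i) : posInd b i = 1 := if_pos h

lemma posInd_of_not_isPos {b : P.Base} {i : ι} (h : ¬ b.IsPos i) : posInd b i = 0 := if_neg h

lemma posInd_eq_one_iff {b : P.Base} {i : ι} : posInd b i = 1 ↔ b.IsPos i := by
  by_cases h : b.IsPos i
  · simp [posInd_of_isPos h, h]
  · simp [posInd_of_not_isPos h, h]

lemma posInd_opp (i : ι) : posInd b (P.reflectionPerm i i) = 1 - posInd b i := by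
  by_cases h : b.IsPos i
  · rw [posInd_of_isPos h, posInd_of_not_isPos (by rw [isPos_opp_iff]; simpa)]; rfl
  · rw [posInd_of_not_isPos h, posInd_of_isPos (by rwa [isPos_opp_iff])]; rfl

lemma posInd_add_le {i j k : ι} (h : P.root k = P.root i + P.root j) :
    posInd b k ≤ posInd b i + posInd b j := by
  have hh := b.height_add h
  unfold posInd
  simp only [Base.isPos_iff]
  split_ifs <;> omega

lemma height_reflectionPerm (i g : ι) :
    b.height (P.reflectionPerm g i) = b.height i - P.pairingIn ℤ i g * b.height g := by
  have h : P.root (P.reflectionPerm g i) = P.root i + (-P.pairingIn ℤ i g) • P.root g := by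
    rw [root_reflectionPerm, reflection_apply_root' ℤ, neg_smul, sub_eq_add_neg]
  rw [b.height_add_zsmul h, smul_eq_mul]
  ring

lemma reflectionPerm_opp (g i : ι) : P.reflectionPerm g (P.reflectionPerm i i) =
    P.reflectionPerm (P.reflectionPerm g i) (P.reflectionPerm g i) := by
  apply P.root.injective
  rw [root_opp, root_reflectionPerm, root_opp, root_reflectionPerm, map_neg]

lemma reflectionPerm_opp_left (g i : ι) :
    P.reflectionPerm (P.reflectionPerm g g) i = P.reflectionPerm g i := by
  apply P.root.injective
  rw [root_reflectionPerm, root_reflectionPerm, reflection_apply_root, reflection_apply_root,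
    root_opp, pairing_reflectionPerm_self_right, neg_smul_neg]

/-- `g` is the finite part of a simple affine root `g + m δ` (and then `m = posInd b g`). -/
def IsSimpleAffine (b : P.Base) (θ g : ι) : Prop := g = θ ∨ P.reflectionPerm g g ∈ b.support

/-- For positive `i ≠ θ` the pairing with the coroot of `θ` is 0 or 1: dominance excludes negative
values, and a value of at least 2 would give a root of height below `-ht θ`. In the first case the
height is unchanged, in the second it becomes negative. Negative `i` follow by passing to opposites.
-/
lemma posInd_reflectionPerm_highestRoot {b : P.Base} (hθ : IsHighestRoot b θ) {i : ι}
    (hi : i ≠ θ) (hi' : i ≠ P.reflectionPerm θ θ) :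
    posInd b (P.reflectionPerm θ i) + P.pairingIn ℤ i θ = posInd b i := by
  cases nonempty_fintype ι
  wlog hp : b.IsPos i generalizing i
  · have h1 := this (i := P.reflectionPerm i i) (fun e ↦ hi' (by rw [← e, opp_opp]))
      (fun e ↦ hi (by rw [← opp_opp (P := P) i, e, opp_opp])) ((isPos_opp_iff b i).2 hp)
    rw [reflectionPerm_opp, posInd_opp, posInd_opp, pairingIn_reflectionPerm_self_left] at h1
    omega
  have hh := height_reflectionPerm b i θ
  have hlt := hθ.height_lt hi
  have hθp := hθ.isPos
  have h0 : 0 ≤ P.pairingIn ℤ i θ := by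
    by_contra! hneg
    have hc := rootForm_comm (P := P) (P.root θ) (P.root (P.reflectionPerm i i))
    rw [root_opp] at hc
    have : 0 < P.pairingIn ℤ (P.reflectionPerm i i) θ := by
      rw [pairingIn_reflectionPerm_self_left]; omega
    rw [pairingIn_pos_iff_rootForm_pos, root_opp, ← hc, map_neg] at this
    have := hθ.rootForm_nonneg hp
    linarith
  have h1 : P.pairingIn ℤ i θ ≤ 1 := by
    by_contra! h2
    have := hθ (P.reflectionPerm (P.reflectionPerm θ i) (P.reflectionPerm θ i))
    rw [height_opp, hh] at this
    rw [Base.isPos_iff] at hp hθp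
    nlinarith
  rcases (by omega : P.pairingIn ℤ i θ = 0 ∨ P.pairingIn ℤ i θ = 1) with h | h
  · have : ¬ ¬ b.IsPos (P.reflectionPerm θ i) := by
      rw [Base.isPos_iff] at hp ⊢; rw [hh, h]; omega
    rw [h, posInd_of_isPos hp, posInd_of_isPos (not_not.1 this)]; rfl
  · have : ¬ b.IsPos (P.reflectionPerm θ i) := by
      rw [Base.isPos_iff] at hp ⊢; rw [hh, h]; omega
    rw [h, posInd_of_isPos hp, posInd_of_not_isPos this]; rfl

lemma posInd_reflectionPerm_of_mem_support {j : ι} (hj : j ∈ b.support) {i : ι}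
    (hi : i ≠ j) (hi' : i ≠ P.reflectionPerm j j) :
    posInd b (P.reflectionPerm j i) = posInd b i := by
  wlog hp : b.IsPos i generalizing i
  · have h1 := this (i := P.reflectionPerm i i) (fun e ↦ hi' (by rw [← e, opp_opp]))
      (fun e ↦ hi (by rw [← opp_opp (P := P) i, e, opp_opp])) ((isPos_opp_iff b i).2 hp)
    rw [reflectionPerm_opp, posInd_opp, posInd_opp] at h1
    omega
  rw [posInd_of_isPos hp, posInd_of_isPos (hp.reflectionPerm hj hi)]

/-- A simple affine reflection permutes the positive affine roots other than its own. -/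
lemma IsSimpleAffine.posInd_reflectionPerm {b : P.Base} (hθ : IsHighestRoot b θ) {g : ι}
    (hg : IsSimpleAffine b θ g) {i : ι} (hi : i ≠ g) (hi' : i ≠ P.reflectionPerm g g) :
    posInd b (P.reflectionPerm g i) + posInd b g * P.pairingIn ℤ i g = posInd b i := by
  rcases hg with rfl | hg
  · rw [posInd_of_isPos hθ.isPos, one_mul]
    exact posInd_reflectionPerm_highestRoot hθ hi hi'
  · have h0 : posInd b g = 0 := by
      rw [← opp_opp (P := P) g, posInd_opp, posInd_of_isPos (Base.isPos_of_mem_support hg)]; rfl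
    rw [h0, zero_mul, add_zero, ← reflectionPerm_opp_left]
    exact posInd_reflectionPerm_of_mem_support b hg hi' (by rwa [opp_opp])

end HighestRoot

/-! ### Splitting decompositions over a lower set of roots -/

section Splitting

variable {ι M N : Type*} [AddCommGroup M] [Module ℝ M] [AddCommGroup N] [Module ℝ N]
  {P : RootPairing ι ℝ M N} (b : P.Base) [Finite ι] [P.IsCrystallographic] [P.IsReduced]

/-- A set of positive roots closed under passing to summands. -/
structure IsLowerRootSet (J : Set ι) : Prop where
  isPos : ∀ i ∈ J, b.IsPos i
  mem_of_add_mem : ∀ i j k, b.IsPos i → b.IsPos j → P.root k = P.root i + P.root j → k ∈ J → i ∈ J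

/-- Expand `(x, x) > 0` along the summands: one of them is positive. This is how a summand to peel
off is chosen in all later inductions on decompositions. -/
lemma exists_mem_rootForm_pos [Fintype ι] {x : M} (hx : x ∈ P.rootSpan ℝ) (hx0 : x ≠ 0)
    {s : Multiset ι} (hs : (s.map P.root).sum = x) :
    ∃ i ∈ s, 0 < P.RootForm (P.root i) x := by
  have h := P.rootForm_pos_of_ne_zero hx hx0
  by_contra! hall
  refine absurd h (not_lt.2 ?_)
  nth_rw 1 [← hs]
  rw [← LinearMap.flip_apply, map_multiset_sum, Multiset.map_map]
  have := Multiset.sum_nonneg (s := s.map fun i ↦ -P.RootForm (P.root i) x)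
    (by simpa using hall)
  rw [Multiset.sum_map_neg] at this
  exact neg_nonneg.1 this

/-- If a sum of two positive roots `i` and `j` is written as the sum of a multiset `s` of roots
of a lower set `J`, then `i` and `j` are sums of roots of `J`, with at most one more summand
in total. -/
lemma IsLowerRootSet.exists_split {b : P.Base} {J : Set ι} (hJ : IsLowerRootSet b J)
    {s : Multiset ι} (hs : ∀ k ∈ s, k ∈ J) {i j : ι} (hi : b.IsPos i) (hj : b.IsPos j)
    (hsum : (s.map P.root).sum = P.root i + P.root j) :
    ∃ s₁ s₂ : Multiset ι, (∀ k ∈ s₁, k ∈ J) ∧ (∀ k ∈ s₂, k ∈ J) ∧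
      (s₁.map P.root).sum = P.root i ∧ (s₂.map P.root).sum = P.root j ∧
      s₁.card + s₂.card ≤ s.card + 1 := by
  classical
  cases nonempty_fintype ι
  generalize hn : s.card = n
  induction n generalizing s i j with
  | zero =>
    exfalso
    rw [Multiset.card_eq_zero.1 hn] at hsum
    have h : P.root i = -P.root j := by
      rw [eq_neg_iff_add_eq_zero, ← hsum]; simp
    rw [← root_opp] at h
    exact (isPos_opp_iff b j).1 (P.root.injective h ▸ hi) hj
  | succ n ih =>
    -- Peel off a summand `g` that pairs positively with `i`. If `g = i`, the rest sums to `j`. If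
    -- `g = i + k` with `k` positive, lowerness puts `i` and `k` in `J`; this case creates the extra
    -- summand. Otherwise `i - g` is positive and the induction hypothesis splits the rest between
    -- `i - g` and `j`.
    have step : ∀ {i j : ι}, b.IsPos i → b.IsPos j →
        (s.map P.root).sum = P.root i + P.root j →
        ∀ g ∈ s, 0 < P.RootForm (P.root g) (P.root i) →
        ∃ s₁ s₂ : Multiset ι, (∀ k ∈ s₁, k ∈ J) ∧ (∀ k ∈ s₂, k ∈ J) ∧
          (s₁.map P.root).sum = P.root i ∧ (s₂.map P.root).sum = P.root j ∧
          s₁.card + s₂.card ≤ n + 1 + 1 := by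
      intro i j hi hj hsum g hg hgi
      obtain ⟨t, rfl⟩ := Multiset.exists_cons_of_mem hg
      have htJ : ∀ k ∈ t, k ∈ J := fun k hk ↦ hs k (Multiset.mem_cons_of_mem hk)
      have hgJ := hs g hg
      rw [Multiset.map_cons, Multiset.sum_cons] at hsum
      rw [Multiset.card_cons] at hn
      have ht : (t.map P.root).sum = P.root i + P.root j - P.root g := by rw [← hsum]; abel
      by_cases hgi' : g = i
      · subst hgi'
        refine ⟨{g}, t, by simpa using hgJ, htJ, by simp, by rw [ht]; abel, ?_⟩
        rw [Multiset.card_singleton]; omega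
      · obtain ⟨k, hk⟩ := exists_root_eq_sub hgi' hgi
        by_cases hkp : b.IsPos k
        · have h1 : P.root g = P.root i + P.root k := by rw [hk]; abel
          have hiJ := hJ.mem_of_add_mem i k g hi hkp h1 hgJ
          have hkJ := hJ.mem_of_add_mem k i g hkp hi (by rw [h1, add_comm]) hgJ
          refine ⟨{i}, k ::ₘ t, by simpa using hiJ, ?_, by simp, ?_, ?_⟩
          · intro l hl
            rcases Multiset.mem_cons.1 hl with rfl | hl
            exacts [hkJ, htJ l hl]
          · rw [Multiset.map_cons, Multiset.sum_cons, ht, hk]; abel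
          · rw [Multiset.card_singleton, Multiset.card_cons]; omega
        · have hk' := (isPos_opp_iff b k).2 hkp
          obtain ⟨s₁, s₂, h1, h2, h3, h4, h5⟩ := ih htJ hk' hj
            (by rw [ht, root_opp, hk]; abel) (by omega)
          refine ⟨g ::ₘ s₁, s₂, ?_, h2, ?_, h4, ?_⟩
          · intro l hl
            rcases Multiset.mem_cons.1 hl with rfl | hl
            exacts [hgJ, h1 l hl]
          · rw [Multiset.map_cons, Multiset.sum_cons, h3, root_opp, hk]; abel
          · rw [Multiset.card_cons]; omega
    have hne : P.root i + P.root j ≠ 0 := by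
      intro h
      rw [← eq_neg_iff_add_eq_zero, ← root_opp] at h
      exact (isPos_opp_iff b j).1 (P.root.injective h ▸ hi) hj
    have hmem : ∀ i, P.root i ∈ P.rootSpan ℝ := fun i ↦
      Submodule.subset_span (Set.mem_range_self i)
    obtain ⟨g, hg, hpos⟩ := exists_mem_rootForm_pos (add_mem (hmem i) (hmem j)) hne hsum
    rw [map_add] at hpos
    -- Pairing positively with `i + j` forces `g` to pair positively with `i` or with `j`, and
    -- `step` is symmetric in the two.
    by_cases hgi : 0 < P.RootForm (P.root g) (P.root i)
    · exact step hi hj hsum g hg hgi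
    · obtain ⟨s₂, s₁, h2, h1, h4, h3, h5⟩ := step hj hi (by rw [hsum, add_comm]) g hg
        (by linarith)
      exact ⟨s₁, s₂, h1, h2, h3, h4, by omega⟩

end Splitting

/-! ### Pairings with the coroot lattice -/

section CorootLattice

variable {ι M N : Type*} [AddCommGroup M] [Module ℝ M] [AddCommGroup N] [Module ℝ N]
  {P : RootPairing ι ℝ M N} [P.IsCrystallographic]

lemma exists_multiset_of_mem_corootLattice {v : N} (hv : v ∈ CorootLattice P) :
    ∃ s : Multiset ι, (s.map P.coroot).sum = v := by
  induction hv using Submodule.span_induction with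
  | mem v hv => obtain ⟨i, rfl⟩ := hv; exact ⟨{i}, by simp⟩
  | zero => exact ⟨0, by simp⟩
  | add v w _ _ hv hw =>
    obtain ⟨s, rfl⟩ := hv
    obtain ⟨t, rfl⟩ := hw
    exact ⟨s + t, by simp⟩
  | smul n v _ hv =>
    obtain ⟨s, rfl⟩ := hv
    obtain ⟨n, rfl | rfl⟩ := n.eq_nat_or_neg
    · exact ⟨n • s, by simp [Multiset.map_nsmul, Multiset.sum_nsmul]⟩
    · refine ⟨n • s.map fun i ↦ P.reflectionPerm i i, ?_⟩
      rw [Multiset.map_nsmul, Multiset.sum_nsmul, Multiset.map_map, neg_smul, natCast_zsmul,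
        ← smul_neg, ← Multiset.sum_map_neg]
      simp

/-- The coroot lattice contains no nonzero (co)minuscule vector. -/
lemma eq_zero_of_forall_le_one [Finite ι] {v : N} (hv : v ∈ CorootLattice P)
    (h : ∀ i, P.toLinearMap (P.root i) v ≤ 1) : v = 0 := by
  obtain ⟨s, rfl⟩ := exists_multiset_of_mem_corootLattice hv
  clear hv
  generalize hn : s.card = n
  induction n using Nat.strong_induction_on generalizing s with
  | _ n ih =>
    by_cases hs : s = 0
    · simp [hs]
    · obtain ⟨g, hg⟩ := Multiset.exists_mem_of_ne_zero hs
      obtain ⟨t, rfl⟩ := Multiset.exists_cons_of_mem hg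
      have h1 := h g
      rw [Multiset.map_cons, Multiset.sum_cons, map_add, root_coroot_eq_pairing, pairing_same,
        map_multiset_sum, Multiset.map_map] at h1
      -- The summand `g` contributes 2 to `⟨g, v⟩ ≤ 1`, so another coroot `l` pairs negatively with
      -- `g`. The two coroots cancel or add up to a coroot (root addition in `P.flip`), which
      -- shortens the sum.
      have hex : ∃ l ∈ t, P.pairingIn ℤ g l < 0 := by
        by_contra! hall
        have : 0 ≤ (t.map (P.toLinearMap (P.root g) ∘ P.coroot)).sum := by
          refine Multiset.sum_nonneg fun x hx ↦ ?_
          obtain ⟨l, hl, rfl⟩ := Multiset.mem_map.1 hx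
          have := hall l hl
          rw [Function.comp_apply, root_coroot_eq_pairing, ← P.algebraMap_pairingIn ℤ]
          simpa using this
        linarith
      obtain ⟨l, hl, hlt⟩ := hex
      obtain ⟨u, rfl⟩ := Multiset.exists_cons_of_mem hl
      have hlt' : P.flip.pairingIn ℤ l g < 0 := by
        have e : P.flip.pairingIn ℤ l g = P.pairingIn ℤ g l := by
          have h1 := P.flip.algebraMap_pairingIn ℤ l g
          have h2 := P.algebraMap_pairingIn ℤ g l
          rw [pairing_flip, ← h2] at h1
          simpa using h1
        rwa [e]
      simp only [Multiset.card_cons] at hn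
      by_cases hz : P.coroot l = -P.coroot g
      · have e : (((g ::ₘ l ::ₘ u).map P.coroot).sum) = (u.map P.coroot).sum := by
          simp [hz]
        rw [e] at h ⊢
        exact ih _ (by omega) u h rfl
      · obtain ⟨k, hk⟩ := P.flip.root_add_root_mem_of_pairingIn_neg hlt' hz
        have hk' : P.coroot k = P.coroot l + P.coroot g := hk
        have e : (((g ::ₘ l ::ₘ u).map P.coroot).sum) = ((k ::ₘ u).map P.coroot).sum := by
          simp only [Multiset.map_cons, Multiset.sum_cons, hk']; abel
        rw [e] at h ⊢
        exact ih _ (by rw [Multiset.card_cons]; omega) _ h rfl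

lemma coe_smul (x : P.weylGroup) (l : CorootLattice P) :
    ((x • l : CorootLattice P) : N) = MulOpposite.op (x : P.Aut)⁻¹ • (l : N) := rfl

lemma root_weylGroupToPerm (x : P.weylGroup) (i : ι) :
    P.root (P.weylGroupToPerm x i) = x • P.root i :=
  (P.weylGroup_apply_root x i).symm

lemma toLinearMap_smul (g : P.Aut) (m : M) (n : N) :
    P.toLinearMap (g • m) n = P.toLinearMap m (MulOpposite.op g • n) :=
  LinearMap.congr_fun (LinearMap.congr_fun (g.weight_coweight_transpose).symm n) m |>.symm

lemma toLinearMap_smul_smul (x : P.weylGroup) (m : M) (l : CorootLattice P) :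
    P.toLinearMap (x • m) ((x • l : CorootLattice P) : N) = P.toLinearMap m (l : N) := by
  rw [coe_smul]
  change P.toLinearMap ((x : P.Aut) • m) _ = _
  rw [toLinearMap_smul, smul_smul, ← MulOpposite.op_mul, inv_mul_cancel, MulOpposite.op_one,
    one_smul]

lemma pair_smul (x : P.weylGroup) (i : ι) (l : CorootLattice P) :
    pair P (P.weylGroupToPerm x i) (x • l) = pair P i l := by
  have : (pair P (P.weylGroupToPerm x i) (x • l) : ℝ) = pair P i l := by
    rw [coe_pair, coe_pair, root_weylGroupToPerm, toLinearMap_smul_smul]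
  exact_mod_cast this

lemma pair_eq_pair_inv_smul (x : P.weylGroup) (i : ι) (l : CorootLattice P) :
    pair P (P.weylGroupToPerm x i) l = pair P i (x⁻¹ • l) := by
  rw [← pair_smul x i, smul_inv_smul]

lemma pair_add_right (i : ι) (l m : CorootLattice P) : pair P i (l + m) = pair P i l + pair P i m :=
  map_add _ _ _

lemma pair_neg_right (i : ι) (l : CorootLattice P) : pair P i (-l) = -pair P i l :=
  map_neg _ _

lemma pair_zero_right (i : ι) : pair P i 0 = 0 := map_zero _

lemma pair_add_left {i j k : ι} (h : P.root k = P.root i + P.root j) (l : CorootLattice P) :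
    pair P k l = pair P i l + pair P j l := by
  have : (pair P k l : ℝ) = pair P i l + pair P j l := by
    rw [coe_pair, coe_pair, coe_pair, h, map_add, LinearMap.add_apply]
  exact_mod_cast this

lemma pair_opp (i : ι) (l : CorootLattice P) :
    pair P (P.reflectionPerm i i) l = -pair P i l := by
  have : (pair P (P.reflectionPerm i i) l : ℝ) = -pair P i l := by
    rw [coe_pair, coe_pair, root_opp, map_neg, LinearMap.neg_apply]
  exact_mod_cast this

lemma pair_coroot (i j : ι) : pair P i (P.corootSpanMem ℤ j) = P.pairingIn ℤ i j :=
  P.root'In_corootSpanMem_eq_pairingIn (S := ℤ) i j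

lemma eq_zero_of_forall_pair_le_one [Finite ι] {l : CorootLattice P} (h : ∀ i, pair P i l ≤ 1) :
    l = 0 := by
  refine Subtype.ext (eq_zero_of_forall_le_one l.2 fun i ↦ ?_)
  rw [← coe_pair]
  exact_mod_cast h i

end CorootLattice

/-! ### The finite Weyl group: exchange condition and faithfulness on positive roots -/

section WeylGroup

variable {ι M N : Type*} [AddCommGroup M] [Module ℝ M] [AddCommGroup N] [Module ℝ N]
  {P : RootPairing ι ℝ M N} [P.IsCrystallographic]

lemma weylGroupToPerm_ofIdx (i : ι) : P.weylGroupToPerm (weylGroup.ofIdx P i) = P.reflectionPerm i :=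
  rfl

lemma weylGroupToPerm_opp (x : P.weylGroup) (i : ι) :
    P.weylGroupToPerm x (P.reflectionPerm i i) =
      P.reflectionPerm (P.weylGroupToPerm x i) (P.weylGroupToPerm x i) := by
  apply P.root.injective
  rw [root_opp, root_weylGroupToPerm, root_weylGroupToPerm, root_opp, smul_neg]

lemma root_weylGroupToPerm_add (x : P.weylGroup) {i j k : ι}
    (h : P.root k = P.root i + P.root j) :
    P.root (P.weylGroupToPerm x k) =
      P.root (P.weylGroupToPerm x i) + P.root (P.weylGroupToPerm x j) := by
  simp only [root_weylGroupToPerm, h, smul_add]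

lemma weylGroupToPerm_injective [P.IsRootSystem] :
    Function.Injective P.weylGroupToPerm := by
  intro x y h
  apply Subtype.ext
  apply Equiv.weightHom_injective P
  apply LinearEquiv.toLinearMap_injective
  have hs : Submodule.span ℝ (Set.range P.root) = ⊤ := by simp
  refine LinearMap.ext_on hs ?_
  rintro - ⟨i, rfl⟩
  change x • P.root i = y • P.root i
  rw [← root_weylGroupToPerm, ← root_weylGroupToPerm, h]

lemma pairing_weylGroupToPerm (x : P.weylGroup) (i j : ι) :
    P.pairing (P.weylGroupToPerm x i) (P.weylGroupToPerm x j) = P.pairing i j := by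
  rw [← root_coroot_eq_pairing, root_weylGroupToPerm]
  change P.toLinearMap ((x : P.Aut) • P.root i) _ = _
  rw [toLinearMap_smul]
  have h : MulOpposite.op (x : P.Aut) • P.coroot (P.weylGroupToPerm x j) =
      P.coroot ((x : P.Aut).indexEquiv.symm (P.weylGroupToPerm x j)) :=
    Hom.coroot_coweightMap_apply (P := P) (Q := P) _ (x : P.Aut).toHom
  rw [h]
  have h2 : (x : P.Aut).indexEquiv.symm (P.weylGroupToPerm x j) = j :=
    (x : P.Aut).indexEquiv.symm_apply_apply j
  rw [h2, root_coroot_eq_pairing]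

lemma weylGroupToPerm_reflectionPerm (x : P.weylGroup) (i j : ι) :
    P.weylGroupToPerm x (P.reflectionPerm i j) =
      P.reflectionPerm (P.weylGroupToPerm x i) (P.weylGroupToPerm x j) := by
  apply P.root.injective
  have h : ∀ (c : ℝ) (m : M), x • (c • m) = c • (x • m) := fun c m ↦ smul_comm (x : P.Aut) c m
  rw [root_weylGroupToPerm, root_reflectionPerm, root_reflectionPerm, reflection_apply_root,
    reflection_apply_root, pairing_weylGroupToPerm, smul_sub, h, root_weylGroupToPerm,
    root_weylGroupToPerm]

lemma mul_ofIdx [P.IsRootSystem] (x : P.weylGroup) (i : ι) :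
    x * weylGroup.ofIdx P i = weylGroup.ofIdx P (P.weylGroupToPerm x i) * x := by
  apply weylGroupToPerm_injective
  ext j
  rw [map_mul, map_mul, Equiv.Perm.mul_apply, Equiv.Perm.mul_apply, weylGroupToPerm_ofIdx,
    weylGroupToPerm_ofIdx, weylGroupToPerm_reflectionPerm]

lemma ofIdx_mul_self [P.IsRootSystem] (i : ι) :
    weylGroup.ofIdx P i * weylGroup.ofIdx P i = 1 := by
  apply weylGroupToPerm_injective
  ext j
  rw [map_mul, Equiv.Perm.mul_apply, weylGroupToPerm_ofIdx, map_one, reflectionPerm_self]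
  rfl

lemma ofIdx_opp [P.IsRootSystem] (i : ι) :
    weylGroup.ofIdx P (P.reflectionPerm i i) = weylGroup.ofIdx P i := by
  apply weylGroupToPerm_injective
  ext j
  rw [weylGroupToPerm_ofIdx, weylGroupToPerm_ofIdx]
  apply P.root.injective
  rw [root_reflectionPerm, root_reflectionPerm, reflection_apply_root, reflection_apply_root,
    root_opp, pairing_reflectionPerm_self_right, neg_smul_neg]

variable (b : P.Base) [Finite ι] [P.IsReduced] [P.IsRootSystem]

lemma ofIdx_mem_closure (i : ι) :
    weylGroup.ofIdx P i ∈ Subgroup.closure (weylGroup.ofIdx P '' (b.support : Set ι)) := by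
  refine b.induction_reflect i
    (p := fun i ↦ weylGroup.ofIdx P i ∈ Subgroup.closure (weylGroup.ofIdx P '' (b.support : Set ι)))
    (fun i hi ↦ by rwa [ofIdx_opp]) (fun i hi ↦ Subgroup.subset_closure ⟨i, hi, rfl⟩) ?_
  intro i j hi hj
  have hj' := Subgroup.subset_closure (Set.mem_image_of_mem (weylGroup.ofIdx P) hj)
  have h := mul_ofIdx (weylGroup.ofIdx P j) i
  rw [weylGroupToPerm_ofIdx, ← mul_inv_eq_iff_eq_mul] at h
  rw [← h]
  exact mul_mem (mul_mem hj' hi) (inv_mem hj')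

lemma exists_list_prod_eq (x : P.weylGroup) :
    ∃ l : List ι, (∀ i ∈ l, i ∈ b.support) ∧ (l.map (weylGroup.ofIdx P)).prod = x := by
  have key : ∀ i, ∃ l : List ι, (∀ i ∈ l, i ∈ b.support) ∧
      (l.map (weylGroup.ofIdx P)).prod = weylGroup.ofIdx P i := by
    intro i
    refine Subgroup.closure_induction'' (p := fun y _ ↦ ∃ l : List ι, (∀ i ∈ l, i ∈ b.support) ∧
      (l.map (weylGroup.ofIdx P)).prod = y) ?_ ?_ ?_ ?_ (ofIdx_mem_closure b i)
    · rintro - ⟨j, hj, rfl⟩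
      exact ⟨[j], by simpa using hj, by simp⟩
    · rintro - ⟨j, hj, rfl⟩
      refine ⟨[j], by simpa using hj, ?_⟩
      rw [eq_inv_iff_mul_eq_one]
      simp [ofIdx_mul_self]
    · exact ⟨[], by simp, by simp⟩
    · rintro x y - - ⟨l, hl, rfl⟩ ⟨m, hm, rfl⟩
      refine ⟨l ++ m, ?_, by simp⟩
      intro i hi
      rcases List.mem_append.1 hi with h | h
      exacts [hl i h, hm i h]
  obtain ⟨x, hx⟩ := x
  induction hx using weylGroup.induction with
  | mem i => exact key i
  | one => exact ⟨[], by simp, by simp; rfl⟩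
  | mul x y hx hy hx' hy' =>
    obtain ⟨l, hl, hl'⟩ := hx'
    obtain ⟨m, hm, hm'⟩ := hy'
    refine ⟨l ++ m, ?_, ?_⟩
    · intro i hi
      rcases List.mem_append.1 hi with h | h
      exacts [hl i h, hm i h]
    · rw [List.map_append, List.prod_append, hl', hm']; rfl

/-- The exchange condition. -/
lemma exists_list_exchange {l : List ι} (hl : ∀ i ∈ l, i ∈ b.support) {j : ι}
    (hj : j ∈ b.support)
    (h : ¬ b.IsPos (P.weylGroupToPerm (l.map (weylGroup.ofIdx P)).prod j)) :
    ∃ l' : List ι, (∀ i ∈ l', i ∈ b.support) ∧ l'.length < l.length ∧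
      (l'.map (weylGroup.ofIdx P)).prod =
        (l.map (weylGroup.ofIdx P)).prod * weylGroup.ofIdx P j := by
  induction l with
  | nil => exact absurd (Base.isPos_of_mem_support hj) (by simpa using h)
  | cons i l ih =>
    have hl' : ∀ i ∈ l, i ∈ b.support := fun k hk ↦ hl k (List.mem_cons_of_mem i hk)
    have hi := hl i List.mem_cons_self
    by_cases hp : b.IsPos (P.weylGroupToPerm (l.map (weylGroup.ofIdx P)).prod j)
    · refine ⟨l, hl', by simp, ?_⟩
      rw [List.map_cons, List.prod_cons, map_mul, Equiv.Perm.mul_apply,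
        weylGroupToPerm_ofIdx] at h
      -- The reflection in `i` negates no positive root except `i`, so the tail of the word sends
      -- `j` to `i`; conjugation then cancels the first letter.
      have hij : P.weylGroupToPerm (l.map (weylGroup.ofIdx P)).prod j = i := by
        by_contra hne
        exact h (hp.reflectionPerm hi hne)
      rw [List.map_cons, List.prod_cons, mul_assoc, mul_ofIdx, hij, ← mul_assoc, ofIdx_mul_self,
        one_mul]
    · obtain ⟨l', h1, h2, h3⟩ := ih hl' hp
      refine ⟨i :: l', ?_, by simpa using h2, ?_⟩
      · intro k hk
        rcases List.mem_cons.1 hk with rfl | hk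
        exacts [hi, h1 k hk]
      · rw [List.map_cons, List.prod_cons, h3, List.map_cons, List.prod_cons, mul_assoc]

/-- Only the identity of the Weyl group preserves the positive roots. -/
lemma eq_one_of_forall_isPos {x : P.weylGroup}
    (h : ∀ i, b.IsPos i → b.IsPos (P.weylGroupToPerm x i)) : x = 1 := by
  obtain ⟨l, hl, rfl⟩ := exists_list_prod_eq b x
  generalize hn : l.length = n
  induction n using Nat.strong_induction_on generalizing l with
  | _ n ih =>
    rcases List.eq_nil_or_concat l with rfl | ⟨t, j, rfl⟩
    · simp
    · rw [List.concat_eq_append] at *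
      have ht : ∀ i ∈ t, i ∈ b.support := fun k hk ↦ hl k (List.mem_append_left _ hk)
      have hj : j ∈ b.support := hl j (by simp)
      -- The whole word keeps `j` positive and its last letter negates `j`, so the prefix sends `j`
      -- to a negative root; exchange then yields a shorter word.
      have hneg : ¬ b.IsPos (P.weylGroupToPerm (t.map (weylGroup.ofIdx P)).prod j) := by
        have := h j (Base.isPos_of_mem_support hj)
        rw [List.map_append, List.prod_append, List.map_singleton, List.prod_singleton, map_mul,
          Equiv.Perm.mul_apply, weylGroupToPerm_ofIdx, weylGroupToPerm_opp, isPos_opp_iff] at this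
        exact this
      obtain ⟨l', h1, h2, h3⟩ := exists_list_exchange b ht hj hneg
      have e : ((t ++ [j]).map (weylGroup.ofIdx P)).prod = (l'.map (weylGroup.ofIdx P)).prod := by
        rw [h3]; simp
      rw [e] at h ⊢
      rw [List.length_append, List.length_singleton] at hn
      exact ih _ (by omega) l' h1 h rfl

end WeylGroup

/-! ### The affine Weyl group acting on threshold functions -/

section ThresholdAction

variable {ι M N : Type*} [AddCommGroup M] [Module ℝ M] [AddCommGroup N] [Module ℝ N]
  {P : RootPairing ι ℝ M N}

lemma finPart_mul (w w' : AffineWeylGroup P) : finPart (w * w') = finPart w * finPart w' := rfl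

lemma finPart_one : finPart (1 : AffineWeylGroup P) = 1 := rfl

lemma transPart_mul (w w' : AffineWeylGroup P) :
    transPart (w * w') = (finPart w')⁻¹ • transPart w + transPart w' := by
  have h : (w * w').left.toAdd = w.left.toAdd + finPart w • w'.left.toAdd := rfl
  change (finPart w * finPart w')⁻¹ • (w * w').left.toAdd = _
  rw [h, smul_add, mul_inv_rev, mul_smul, mul_smul, inv_smul_smul]
  rfl

lemma transPart_one : transPart (1 : AffineWeylGroup P) = 0 := by
  change (1 : P.weylGroup)⁻¹ • (0 : CorootLattice P) = 0
  rw [smul_zero]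

lemma affineWeylGroup_ext {w w' : AffineWeylGroup P} (h : finPart w = finPart w')
    (h' : transPart w = transPart w') : w = w' := by
  rw [eq_ofWeyl_mul_tau w, eq_ofWeyl_mul_tau w', h, h']

variable [P.IsCrystallographic]

/-- A function `K` on the roots stands for the set of affine roots `α + m δ` with `K α ≤ m`.
This is the induced action of the affine Weyl group on such functions. -/
noncomputable def thrAct (w : AffineWeylGroup P) (K : ι → ℤ) (i : ι) : ℤ :=
  K (P.weylGroupToPerm (finPart w)⁻¹ i) + pair P (P.weylGroupToPerm (finPart w)⁻¹ i) (transPart w)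

lemma thrAct_perm (w : AffineWeylGroup P) (K : ι → ℤ) (i : ι) :
    thrAct w K (P.weylGroupToPerm (finPart w) i) = K i + pair P i (transPart w) := by
  have : P.weylGroupToPerm (finPart w)⁻¹ (P.weylGroupToPerm (finPart w) i) = i := by
    rw [map_inv]
    exact Equiv.symm_apply_apply _ _
  rw [thrAct, this]

lemma exists_perm_eq (x : P.weylGroup) (i : ι) : ∃ j, P.weylGroupToPerm x j = i :=
  (P.weylGroupToPerm x).surjective i

lemma thrAct_mul (w w' : AffineWeylGroup P) (K : ι → ℤ) :
    thrAct (w * w') K = thrAct w (thrAct w' K) := by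
  ext i
  obtain ⟨j, rfl⟩ := exists_perm_eq (finPart (w * w')) i
  rw [thrAct_perm, finPart_mul, map_mul, Equiv.Perm.mul_apply, thrAct_perm, thrAct_perm,
    transPart_mul, pair_add_right, pair_eq_pair_inv_smul]
  ring

lemma thrAct_one (K : ι → ℤ) : thrAct (1 : AffineWeylGroup P) K = K := by
  ext i
  rw [thrAct, transPart_one, pair_zero_right, add_zero, finPart_one, inv_one, map_one]
  rfl

/-- The functions that describe a positive system of affine roots. -/
structure IsAddress (P : RootPairing ι ℝ M N) (K : ι → ℤ) : Prop where
  opp : ∀ i, K (P.reflectionPerm i i) = 1 - K i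
  add_le : ∀ i j k, P.root k = P.root i + P.root j → K k ≤ K i + K j

lemma IsAddress.act {K : ι → ℤ} (hK : IsAddress P K) (w : AffineWeylGroup P) :
    IsAddress P (thrAct w K) where
  opp i := by
    rw [thrAct, weylGroupToPerm_opp, hK.opp, pair_opp, thrAct]
    ring
  add_le i j k h := by
    have h' := root_weylGroupToPerm_add (finPart w)⁻¹ h
    have h1 := hK.add_le _ _ _ h'
    have h2 := pair_add_left h' (transPart w)
    unfold thrAct
    omega

/-- Apply subadditivity to `i = k + (-j)`. So on a sum of roots an address is additive up to a
defect of 0 or 1. -/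
lemma IsAddress.le_add {K : ι → ℤ} (hK : IsAddress P K) {i j k : ι}
    (h : P.root k = P.root i + P.root j) : K i + K j ≤ K k + 1 := by
  have := hK.add_le k (P.reflectionPerm j j) i (by rw [root_opp, h]; abel)
  rw [hK.opp] at this
  omega

end ThresholdAction

/-! ### Addresses, affine Weyl group elements and length -/

section Base

variable {ι M N : Type*} [AddCommGroup M] [Module ℝ M] [AddCommGroup N] [Module ℝ N]
  {P : RootPairing ι ℝ M N} (b : P.Base) [Finite ι] [P.IsCrystallographic] [P.IsReduced]
  [P.IsRootSystem] [P.IsIrreducible] {θ : ι}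

lemma isAddress_posInd : IsAddress P (posInd b) where
  opp := posInd_opp b
  add_le _ _ _ h := posInd_add_le b h

/-- The address of the alcove of `w`: the affine root `α + m δ` is made positive by `w⁻¹` if and
only if `address b w α ≤ m`. -/
noncomputable def address (w : AffineWeylGroup P) : ι → ℤ := thrAct w (posInd b)

lemma isAddress_address (w : AffineWeylGroup P) : IsAddress P (address b w) :=
  (isAddress_posInd b).act w

lemma isPosAffine_iff (a : ι × ℤ) : IsPosAffine b a ↔ posInd b a.1 ≤ a.2 := by
  rw [IsPosAffine, isPos_opp_iff]
  by_cases h : b.IsPos a.1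
  · rw [posInd_of_isPos h]; simp [h]; omega
  · rw [posInd_of_not_isPos h]; simp [h]

/-- The inversions over `i` are the `m` with `posInd b i ≤ m < address b w i`. -/
lemma mem_supp_iff (w : AffineWeylGroup P) (i : ι) :
    i ∈ supp b w ↔ posInd b i < address b w i := by
  have ht : transPart w⁻¹ = -(finPart w • transPart w) := by
    have h : transPart (w⁻¹ * w) = 0 := by rw [inv_mul_cancel, transPart_one]
    rw [transPart_mul] at h
    rw [← smul_neg]
    exact inv_smul_eq_iff.1 (eq_neg_of_add_eq_zero_left h)
  have hp : ∀ j, pair P j (transPart w⁻¹) =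
      -pair P (P.weylGroupToPerm (finPart w)⁻¹ j) (transPart w) := by
    intro j
    rw [ht, pair_neg_right, pair_eq_pair_inv_smul, inv_inv]
  have hf : finPart w⁻¹ = (finPart w)⁻¹ := rfl
  have key : ∀ m : ℤ, (i, m) ∈ invSet b w ↔ posInd b i ≤ m ∧ m < address b w i := by
    intro m
    change IsPosAffine b (i, m) ∧ ¬ IsPosAffine b _ ↔ _
    rw [isPosAffine_iff, isPosAffine_iff, not_le]
    simp only [affineRootAct, hf, hp, address, thrAct]
    refine and_congr_right fun _ ↦ ⟨fun h ↦ ?_, fun h ↦ ?_⟩ <;> linarith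
  constructor
  · rintro ⟨m, hm⟩
    rw [key] at hm
    omega
  · intro h
    exact ⟨posInd b i, (key _).2 ⟨le_rfl, h⟩⟩

lemma pairingIn_reflectionPerm_left (g i : ι) :
    P.pairingIn ℤ (P.reflectionPerm g i) g = -P.pairingIn ℤ i g := by
  rw [← pairingIn_reflectionPerm, pairingIn_reflectionPerm_self_right]

/-- The affine reflection in `g + m δ`, where `m = posInd b g`. -/
noncomputable def affineReflection (g : ι) : AffineWeylGroup P :=
  ofWeyl P (weylGroup.ofIdx P g) * tau P (-(posInd b g • P.corootSpanMem ℤ g))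

lemma mem_simpleReflections_iff {b : P.Base} (hθ : IsHighestRoot b θ) (s : AffineWeylGroup P) :
    s ∈ simpleReflections b θ ↔ ∃ g, IsSimpleAffine b θ g ∧ s = affineReflection b g := by
  have hθ' : affineReflection b θ =
      ofWeyl P (weylGroup.ofIdx P θ) * tau P (-P.corootSpanMem ℤ θ) := by
    rw [affineReflection, posInd_of_isPos hθ.isPos, one_smul]
  have hj : ∀ j ∈ b.support, affineReflection b (P.reflectionPerm j j) =
      ofWeyl P (weylGroup.ofIdx P j) := by
    intro j hj
    rw [affineReflection, posInd_opp, posInd_of_isPos (Base.isPos_of_mem_support hj), sub_self,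
      zero_smul, neg_zero, ofIdx_opp]
    exact mul_one _
  constructor
  · rintro (rfl | ⟨j, hj', rfl⟩)
    · exact ⟨θ, Or.inl rfl, hθ'.symm⟩
    · exact ⟨P.reflectionPerm j j, Or.inr (by rw [opp_opp]; exact hj'), (hj j hj').symm⟩
  · rintro ⟨g, rfl | hg, rfl⟩
    · exact Or.inl hθ'
    · refine Or.inr ⟨_, hg, ?_⟩
      change ofWeyl P (weylGroup.ofIdx P _) = _
      rw [← hj _ hg, opp_opp]

lemma thrAct_affineReflection (g : ι) (K : ι → ℤ) (i : ι) :
    thrAct (affineReflection b g) K i =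
      K (P.reflectionPerm g i) + posInd b g * P.pairingIn ℤ i g := by
  have hx : finPart (affineReflection b g) = weylGroup.ofIdx P g := finPart_ofWeyl_mul_tau _ _ _
  have ht : transPart (affineReflection b g) = -(posInd b g • P.corootSpanMem ℤ g) :=
    transPart_ofWeyl_mul_tau _ _ _
  have hp := pairingIn_reflectionPerm_left (P := P) g i
  have hs : ∀ (j : ι) (n : ℤ) (l : CorootLattice P), pair P j (n • l) = n * pair P j l :=
    fun j n l ↦ map_zsmul (P.root'In ℤ j) n l
  have := thrAct_perm (affineReflection b g) K (P.reflectionPerm g i)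
  rw [hx, weylGroupToPerm_ofIdx, reflectionPerm_self, ht, pair_neg_right, hs, pair_coroot, hp]
    at this
  rw [this]
  ring

lemma thrAct_affineReflection_self (g : ι) (K : ι → ℤ) :
    thrAct (affineReflection b g) (thrAct (affineReflection b g) K) = K := by
  ext i
  rw [thrAct_affineReflection, thrAct_affineReflection, reflectionPerm_self,
    pairingIn_reflectionPerm_left]
  ring

/-- The number of positive affine roots `α + m δ` with `m < K α`. -/
noncomputable def excess [Fintype ι] (K : ι → ℤ) : ℤ := ∑ i, max 0 (K i - posInd b i)

lemma excess_nonneg [Fintype ι] (K : ι → ℤ) : 0 ≤ excess b K :=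
  Finset.sum_nonneg fun _ _ ↦ le_max_left _ _

/-- After reindexing by the reflection, all terms agree except those at `g` and its opposite. With
`d = K g - posInd b g`, these two contribute `|d|` before and `|d - 1|` after. -/
lemma excess_thrAct [Fintype ι] {b : P.Base} (hθ : IsHighestRoot b θ) {g : ι}
    (hg : IsSimpleAffine b θ g) {K : ι → ℤ} (hK : IsAddress P K) :
    excess b (thrAct (affineReflection b g) K) =
      excess b K + if posInd b g < K g then -1 else 1 := by
  have h1 : excess b (thrAct (affineReflection b g) K) =
      ∑ i, max 0 (K i - posInd b g * P.pairingIn ℤ i g - posInd b (P.reflectionPerm g i)) := by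
    rw [excess, ← Equiv.sum_comp (P.reflectionPerm g)]
    refine Finset.sum_congr rfl fun i _ ↦ ?_
    rw [thrAct_affineReflection, reflectionPerm_self, pairingIn_reflectionPerm_left]
    congr 1
    ring
  rw [← sub_eq_iff_eq_add', h1, excess, ← Finset.sum_sub_distrib]
  have hne : g ≠ P.reflectionPerm g g := by
    intro h
    have := hK.opp g
    rw [← h] at this
    omega
  rw [Fintype.sum_eq_add g (P.reflectionPerm g g) hne]
  · rw [reflectionPerm_self, posInd_opp, hK.opp, pairingIn_reflectionPerm_self_left, pairingIn_same]
    split_ifs <;> omega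
  · rintro i ⟨hi, hi'⟩
    have := hg.posInd_reflectionPerm hθ hi hi'
    rw [sub_sub, add_comm, this, sub_self]

/-- The only address that does not exceed `posInd b` at any simple affine root is `posInd b`. -/
lemma IsAddress.eq_posInd {b : P.Base} (hθ : IsHighestRoot b θ) {K : ι → ℤ} (hK : IsAddress P K)
    (h : ∀ g, IsSimpleAffine b θ g → K g ≤ posInd b g) : K = posInd b := by
  have hs : ∀ j ∈ b.support, 1 ≤ K j := by
    intro j hj
    have := h (P.reflectionPerm j j) (Or.inr (by rwa [opp_opp]))
    rw [hK.opp, posInd_opp, posInd_of_isPos (Base.isPos_of_mem_support hj)] at this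
    omega
  have hpos : ∀ i, b.IsPos i → 1 ≤ K i := by
    intro i hi
    refine hi.induction_on_add (p := fun i ↦ 1 ≤ K i) hs ?_
    intro i j k hk hi hj
    have := hK.le_add hk
    have := hs j hj
    omega
  -- The lower bound climbs from the simple roots; the upper bound descends from `θ`. Both use `K i
  -- + K j ≤ K k + 1` with `K j ≥ 1` for simple `j`.
  have hle : ∀ i, b.IsPos i → K i ≤ 1 := by
    intro i hi
    refine hθ.induction (p := fun i ↦ K i ≤ 1) ?_ ?_ hi
    · have := h θ (Or.inl rfl)
      rwa [posInd_of_isPos hθ.isPos] at this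
    · intro i j k _ hj hk hk1
      have := hK.le_add hk
      have := hs j hj
      omega
  ext i
  by_cases hi : b.IsPos i
  · rw [posInd_of_isPos hi]
    exact le_antisymm (hle i hi) (hpos i hi)
  · have hi' := (isPos_opp_iff b i).2 hi
    have h1 := hle _ hi'
    have h2 := hpos _ hi'
    rw [hK.opp] at h1 h2
    rw [posInd_of_not_isPos hi]
    omega

/-- Every address is the address of an alcove, reached by a word of the expected length. -/
lemma IsAddress.exists_word [Fintype ι] {b : P.Base} (hθ : IsHighestRoot b θ) {K : ι → ℤ}
    (hK : IsAddress P K) : ∃ l : List (AffineWeylGroup P),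
      (∀ s ∈ l, s ∈ simpleReflections b θ) ∧ (l.length : ℤ) = excess b K ∧
      address b l.prod = K := by
  generalize hn : (excess b K).toNat = n
  induction n generalizing K with
  | zero =>
    have h0 : excess b K = 0 := by have := excess_nonneg b K; omega
    have h1 := (Finset.sum_eq_zero_iff_of_nonneg (fun _ _ ↦ le_max_left _ _)).1 h0
    refine ⟨[], by simp, by simp [h0], ?_⟩
    rw [List.prod_nil, address, thrAct_one]
    refine (hK.eq_posInd hθ fun g _ ↦ ?_).symm
    have := h1 g (Finset.mem_univ g)
    omega
  | succ n ih =>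
    -- If no simple affine reflection lowered the excess, `K` would be the fundamental address,
    -- whose excess is 0.
    have hex : ∃ g, IsSimpleAffine b θ g ∧ posInd b g < K g := by
      by_contra! hall
      rw [hK.eq_posInd hθ hall] at hn
      simp [excess] at hn
    obtain ⟨g, hg, hlt⟩ := hex
    have h1 := excess_thrAct hθ hg hK
    rw [if_pos hlt] at h1
    obtain ⟨l, hl, hlen, hl'⟩ := ih (hK.act (affineReflection b g)) (by omega)
    refine ⟨affineReflection b g :: l, ?_, ?_, ?_⟩
    · intro s hs
      rcases List.mem_cons.1 hs with rfl | hs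
      exacts [(mem_simpleReflections_iff hθ _).2 ⟨g, hg, rfl⟩, hl s hs]
    · rw [List.length_cons]; push_cast; omega
    · rw [List.prod_cons, address, thrAct_mul]
      change thrAct _ (address b l.prod) = K
      rw [hl', thrAct_affineReflection_self]

lemma IsAddress.exists_address_eq {b : P.Base} (hθ : IsHighestRoot b θ) {K : ι → ℤ}
    (hK : IsAddress P K) : ∃ w : AffineWeylGroup P, address b w = K := by
  cases nonempty_fintype ι
  obtain ⟨l, -, -, h⟩ := hK.exists_word hθ
  exact ⟨l.prod, h⟩

/-- It suffices to see that the stabiliser of `posInd` is trivial. The translation part of a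
stabilising element is a difference of 0/1 values on every root, hence zero by
`eq_zero_of_forall_pair_le_one`; its finite part then preserves the positive roots. -/
lemma address_injective : Function.Injective (address b : AffineWeylGroup P → ι → ℤ) := by
  intro w w' h
  have h1 : address b (w⁻¹ * w') = posInd b := by
    rw [address, thrAct_mul]
    change thrAct w⁻¹ (address b w') = _
    rw [← h, address, ← thrAct_mul, inv_mul_cancel, thrAct_one]
  rw [← inv_mul_eq_one]
  generalize w⁻¹ * w' = u at h1
  have h2 : ∀ i, posInd b i + pair P i (transPart u) =
      posInd b (P.weylGroupToPerm (finPart u) i) := by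
    intro i
    rw [← thrAct_perm]
    exact congrFun h1 _
  have h01 : ∀ i, posInd b i = 0 ∨ posInd b i = 1 := by
    intro i; unfold posInd; split_ifs <;> simp
  have h3 : transPart u = 0 := by
    refine eq_zero_of_forall_pair_le_one fun i ↦ ?_
    have := h2 i
    have := h01 i
    have := h01 (P.weylGroupToPerm (finPart u) i)
    omega
  refine affineWeylGroup_ext ?_ (h3.trans transPart_one.symm)
  refine eq_one_of_forall_isPos b fun i hi ↦ ?_
  rw [← posInd_eq_one_iff, ← h2, h3, pair_zero_right, posInd_of_isPos hi, add_zero]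

/-- Each letter changes the excess by 1 or -1, so no word for an element is shorter than its excess.
-/
lemma excess_address_prod_le [Fintype ι] {b : P.Base} (hθ : IsHighestRoot b θ)
    (l : List (AffineWeylGroup P)) (hl : ∀ s ∈ l, s ∈ simpleReflections b θ) :
    excess b (address b l.prod) ≤ l.length := by
  induction l with
  | nil => simp [address, thrAct_one, excess]
  | cons s l ih =>
    have h1 := ih fun t ht ↦ hl t (List.mem_cons_of_mem s ht)
    obtain ⟨g, hg, rfl⟩ := (mem_simpleReflections_iff hθ s).1 (hl s List.mem_cons_self)
    have h2 := excess_thrAct hθ hg (isAddress_address b l.prod)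
    rw [List.prod_cons, address, thrAct_mul, List.length_cons]
    change excess b (thrAct _ (address b l.prod)) ≤ _
    rw [h2]
    push_cast
    split_ifs <;> omega

/-- The length of `w` is the number of its inversions. -/
lemma length_eq_excess [Fintype ι] {b : P.Base} (hθ : IsHighestRoot b θ)
    (w : AffineWeylGroup P) : (length b θ w : ℤ) = excess b (address b w) := by
  obtain ⟨l, hl, hlen, hl'⟩ := (isAddress_address b w).exists_word hθ
  have hw : l.prod = w := address_injective b hl'
  have hmem : l.length ∈ {n | ∃ l : List (AffineWeylGroup P),
      l.length = n ∧ (∀ s ∈ l, s ∈ simpleReflections b θ) ∧ l.prod = w} := ⟨l, rfl, hl, hw⟩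
  have h1 : length b θ w ≤ l.length := Nat.sInf_le hmem
  obtain ⟨l', h2, h3, h4⟩ := Nat.sInf_mem ⟨_, hmem⟩
  have h5 := excess_address_prod_le hθ l' h3
  rw [h4] at h5
  change l'.length = length b θ w at h2
  omega

end Base

/-! ### Minimal decompositions and the longest element of a sign type -/

section Ideals

variable {ι M N : Type*} [AddCommGroup M] [Module ℝ M] [AddCommGroup N] [Module ℝ N]
  {P : RootPairing ι ℝ M N} (b : P.Base) [Finite ι] [P.IsCrystallographic] [P.IsReduced]
  [P.IsRootSystem] [P.IsIrreducible] {θ : ι}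

/-- The least number of roots in `J` whose sum is the root `i`. -/
noncomputable def minParts (P : RootPairing ι ℝ M N) (J : Set ι) (i : ι) : ℕ :=
  sInf {n | ∃ s : Multiset ι, s.card = n ∧ (∀ k ∈ s, k ∈ J) ∧ (s.map P.root).sum = P.root i}

lemma minParts_le {J : Set ι} {i : ι} {s : Multiset ι} (hs : ∀ k ∈ s, k ∈ J)
    (hsum : (s.map P.root).sum = P.root i) : minParts P J i ≤ s.card :=
  Nat.sInf_le ⟨s, rfl, hs, hsum⟩

lemma exists_card_eq_minParts {b : P.Base} {J : Set ι} (hJ : (b.support : Set ι) ⊆ J) {i : ι}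
    (hi : b.IsPos i) : ∃ s : Multiset ι, s.card = minParts P J i ∧ (∀ k ∈ s, k ∈ J) ∧
      (s.map P.root).sum = P.root i := by
  have hex : ∃ s : Multiset ι, (∀ k ∈ s, k ∈ J) ∧ (s.map P.root).sum = P.root i := by
    refine hi.induction_on_add
      (p := fun i ↦ ∃ s : Multiset ι, (∀ k ∈ s, k ∈ J) ∧ (s.map P.root).sum = P.root i) ?_ ?_
    · exact fun i hi ↦ ⟨{i}, by simpa using hJ hi, by simp⟩
    · rintro i j k hk ⟨s, hs, hsum⟩ hj
      refine ⟨j ::ₘ s, ?_, by simp [hsum, hk, add_comm]⟩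
      intro l hl
      rcases Multiset.mem_cons.1 hl with rfl | hl
      exacts [hJ hj, hs l hl]
  obtain ⟨s, hs, hsum⟩ := hex
  exact Nat.sInf_mem (s := {n | ∃ s : Multiset ι, s.card = n ∧ (∀ k ∈ s, k ∈ J) ∧
    (s.map P.root).sum = P.root i}) ⟨_, s, rfl, hs, hsum⟩

lemma one_le_minParts {b : P.Base} {J : Set ι} (hJ : (b.support : Set ι) ⊆ J) {i : ι}
    (hi : b.IsPos i) : 1 ≤ minParts P J i := by
  obtain ⟨s, hcard, -, hsum⟩ := exists_card_eq_minParts hJ hi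
  by_contra! h
  rw [Nat.lt_one_iff.1 h, Multiset.card_eq_zero] at hcard
  rw [hcard] at hsum
  exact P.ne_zero i (by simpa using hsum.symm)

lemma minParts_eq_one_iff {b : P.Base} {J : Set ι} (hJ : (b.support : Set ι) ⊆ J) {i : ι}
    (hi : b.IsPos i) : minParts P J i = 1 ↔ i ∈ J := by
  constructor
  · intro h
    obtain ⟨s, hcard, hs, hsum⟩ := exists_card_eq_minParts hJ hi
    rw [h, Multiset.card_eq_one] at hcard
    obtain ⟨k, rfl⟩ := hcard
    rw [Multiset.map_singleton, Multiset.sum_singleton] at hsum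
    exact P.root.injective hsum ▸ hs k (Multiset.mem_singleton_self k)
  · intro h
    refine le_antisymm ?_ (one_le_minParts hJ hi)
    exact minParts_le (s := {i}) (by simpa using h) (by simp)

lemma minParts_add_le {b : P.Base} {J : Set ι} (hJ : (b.support : Set ι) ⊆ J) {i j k : ι}
    (hi : b.IsPos i) (hj : b.IsPos j) (hk : P.root k = P.root i + P.root j) :
    minParts P J k ≤ minParts P J i + minParts P J j := by
  obtain ⟨s, hs, hsJ, hsum⟩ := exists_card_eq_minParts hJ hi
  obtain ⟨t, ht, htJ, htsum⟩ := exists_card_eq_minParts hJ hj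
  rw [← hs, ← ht, ← Multiset.card_add]
  refine minParts_le ?_ (by simp [hsum, htsum, hk])
  intro l hl
  rcases Multiset.mem_add.1 hl with h | h
  exacts [hsJ l h, htJ l h]

/-- Split a shortest decomposition of `k`; the one extra summand allowed there is exactly the defect
that an address may have. -/
lemma minParts_add_minParts_le {b : P.Base} {J : Set ι} (hJ : (b.support : Set ι) ⊆ J)
    (hJ' : IsLowerRootSet b J) {i j k : ι} (hi : b.IsPos i) (hj : b.IsPos j)
    (hk : P.root k = P.root i + P.root j) :
    minParts P J i + minParts P J j ≤ minParts P J k + 1 := by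
  obtain ⟨s, hs, hsJ, hsum⟩ := exists_card_eq_minParts hJ (hi.add hj hk)
  obtain ⟨s₁, s₂, h1, h2, h3, h4, h5⟩ := hJ'.exists_split hsJ hi hj (hsum.trans hk)
  have := minParts_le h1 h3
  have := minParts_le h2 h4
  omega

open Classical in
/-- The odd extension of `minParts` to all roots. -/
noncomputable def maxAddress (J : Set ι) (i : ι) : ℤ :=
  if b.IsPos i then minParts P J i else 1 - minParts P J (P.reflectionPerm i i)

lemma maxAddress_of_isPos {b : P.Base} (J : Set ι) {i : ι} (hi : b.IsPos i) :
    maxAddress b J i = minParts P J i := if_pos hi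

lemma maxAddress_of_not_isPos {b : P.Base} (J : Set ι) {i : ι} (hi : ¬ b.IsPos i) :
    maxAddress b J i = 1 - minParts P J (P.reflectionPerm i i) := if_neg hi

lemma isAddress_maxAddress {J : Set ι} (hJ : (b.support : Set ι) ⊆ J)
    (hJ' : IsLowerRootSet b J) : IsAddress P (maxAddress b J) where
  opp i := by
    by_cases hi : b.IsPos i
    · rw [maxAddress_of_isPos J hi, maxAddress_of_not_isPos J (by rw [isPos_opp_iff]; simpa),
        opp_opp]
    · rw [maxAddress_of_not_isPos J hi, maxAddress_of_isPos J (by rwa [isPos_opp_iff])]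
      ring
  add_le i j k hk := by
    -- With `j` negative, rearrange into an identity between positive roots: `i = k + (-j)` if `k`
    -- is positive, which needs the splitting inequality, and `-j = i + (-k)` otherwise, which needs
    -- only subadditivity.
    have mixed : ∀ i j k, P.root k = P.root i + P.root j → b.IsPos i → ¬ b.IsPos j →
        maxAddress b J k ≤ maxAddress b J i + maxAddress b J j := by
      intro i j k hk hi hj
      have hj' := (isPos_opp_iff b j).2 hj
      rw [maxAddress_of_isPos J hi, maxAddress_of_not_isPos J hj]
      by_cases hkp : b.IsPos k
      · have := minParts_add_minParts_le hJ hJ' hkp hj' (k := i) (by rw [root_opp, hk]; abel)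
        rw [maxAddress_of_isPos J hkp]
        omega
      · have hk' := (isPos_opp_iff b k).2 hkp
        have := minParts_add_le hJ hi hk' (k := P.reflectionPerm j j)
          (by rw [root_opp, root_opp, hk]; abel)
        rw [maxAddress_of_not_isPos J hkp]
        omega
    by_cases hi : b.IsPos i <;> by_cases hj : b.IsPos j
    · rw [maxAddress_of_isPos J hi, maxAddress_of_isPos J hj, maxAddress_of_isPos J (hi.add hj hk)]
      exact_mod_cast minParts_add_le hJ hi hj hk
    · exact mixed i j k hk hi hj
    · rw [add_comm]
      exact mixed j i k (by rw [hk, add_comm]) hj hi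
    · have hi' := (isPos_opp_iff b i).2 hi
      have hj' := (isPos_opp_iff b j).2 hj
      have hk' : P.root (P.reflectionPerm k k) =
          P.root (P.reflectionPerm i i) + P.root (P.reflectionPerm j j) := by
        rw [root_opp, root_opp, root_opp, hk]; abel
      have := minParts_add_minParts_le hJ hJ' hi' hj' hk'
      rw [maxAddress_of_not_isPos J hi, maxAddress_of_not_isPos J hj,
        maxAddress_of_not_isPos J ((isPos_opp_iff b k).1 (hi'.add hj' hk'))]
      omega

/-- An address that is at most `1` on `J` is at most the number of summands on a sum of
roots in `J`. -/
lemma IsAddress.le_card {K : ι → ℤ} (hK : IsAddress P K) {J : Set ι} (h1 : ∀ j ∈ J, K j ≤ 1)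
    {s : Multiset ι} (hs : ∀ k ∈ s, k ∈ J) {i : ι} (hsum : (s.map P.root).sum = P.root i) :
    K i ≤ s.card := by
  cases nonempty_fintype ι
  generalize hn : s.card = n
  induction n generalizing s i with
  | zero =>
    rw [Multiset.card_eq_zero.1 hn] at hsum
    exact absurd hsum.symm (by simpa using P.ne_zero i)
  | succ n ih =>
    -- A summand pairing positively with `i` can be removed so that the rest still sums to a root,
    -- unless it is `i` itself. Subadditivity can thus be applied one summand at a time.
    obtain ⟨g, hg, hpos⟩ := exists_mem_rootForm_pos
      (Submodule.subset_span (Set.mem_range_self i)) (P.ne_zero i) hsum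
    obtain ⟨t, rfl⟩ := Multiset.exists_cons_of_mem hg
    have hg1 := h1 g (hs g hg)
    by_cases hgi : g = i
    · subst hgi; push_cast; omega
    · rw [rootForm_comm] at hpos
      obtain ⟨k, hk⟩ := exists_root_eq_sub (Ne.symm hgi) hpos
      rw [Multiset.map_cons, Multiset.sum_cons] at hsum
      rw [Multiset.card_cons] at hn
      have := ih (fun l hl ↦ hs l (Multiset.mem_cons_of_mem hl))
        (i := k) (by rw [hk, ← hsum]; abel) (by omega)
      have := hK.add_le g k i (by rw [hk]; abel)
      push_cast
      omega

lemma IsAddress.le_maxAddress {b : P.Base} {K : ι → ℤ} (hK : IsAddress P K) {J : Set ι}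
    (hJ : (b.support : Set ι) ⊆ J) (h1 : ∀ j ∈ J, K j ≤ 1) {i : ι} (hi : b.IsPos i) :
    K i ≤ maxAddress b J i := by
  obtain ⟨s, hcard, hs, hsum⟩ := exists_card_eq_minParts hJ hi
  rw [maxAddress_of_isPos J hi, ← hcard]
  exact hK.le_card h1 hs hsum

/-- The positive roots outside `I`. -/
def posCompl (I : Set ι) : Set ι := {i | b.IsPos i ∧ i ∉ I}

lemma IsIdeal.isLowerRootSet {b : P.Base} {I : Set ι} (hI : IsIdeal b I) :
    IsLowerRootSet b (posCompl b I) where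
  isPos _ h := h.1
  mem_of_add_mem i j k hi hj hk hkJ :=
    ⟨hi, fun hiI ↦ hkJ.2 (hI.add_mem i hiI j k hj (hi.add hj hk) hk)⟩

lemma IsStrictlyPositiveIdeal.support_subset {b : P.Base} {I : Set ι}
    (hI : IsStrictlyPositiveIdeal b I) : (b.support : Set ι) ⊆ posCompl b I :=
  fun _ hi ↦ ⟨Base.isPos_of_mem_support hi, fun hiI ↦ Set.disjoint_left.1 hI.disjoint hiI hi⟩

/-- As `I` has no negative roots, neither may the support; by oddness this says that the address is
at least 1 on positive roots. -/
lemma mem_signType_iff {I : Set ι} (hI : ∀ i ∈ I, b.IsPos i) (w : AffineWeylGroup P) :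
    w ∈ signType b I ↔ ∀ i, b.IsPos i → 1 ≤ address b w i ∧ (i ∈ I ↔ 2 ≤ address b w i) := by
  have hK := isAddress_address b w
  constructor
  · rintro rfl i hi
    constructor
    · by_contra! hlt
      refine (isPos_opp_iff b i).1 (hI (P.reflectionPerm i i) ?_) hi
      rw [mem_supp_iff, hK.opp, posInd_opp, posInd_of_isPos hi]
      omega
    · rw [mem_supp_iff, posInd_of_isPos hi]
      omega
  · intro h
    ext i
    rw [mem_supp_iff]
    by_cases hi : b.IsPos i
    · rw [posInd_of_isPos hi, (h i hi).2]; omega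
    · have h1 := (h _ ((isPos_opp_iff b i).2 hi)).1
      rw [hK.opp] at h1
      rw [posInd_of_not_isPos hi]
      exact ⟨fun h2 ↦ by omega, fun h2 ↦ absurd (hI i h2) hi⟩

/-- Every address in the sign type is bounded by `maxAddress` on positive roots, and negative roots
contribute nothing to the excess. Maximal length therefore forces equality root by root. -/
lemma isMaxElement_iff {b : P.Base} (hθ : IsHighestRoot b θ) {I : Set ι}
    (hI : IsStrictlyPositiveIdeal b I) (w : AffineWeylGroup P) :
    IsMaxElement b θ I w ↔ address b w = maxAddress b (posCompl b I) := by
  cases nonempty_fintype ι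
  have hJ := hI.support_subset
  have hmax := isAddress_maxAddress b hJ hI.isLowerRootSet
  have hsupp : ∀ w, address b w = maxAddress b (posCompl b I) → w ∈ signType b I := by
    intro w hw
    rw [mem_signType_iff b hI.isPos]
    intro i hi
    have h1 := one_le_minParts hJ hi
    have h2 := minParts_eq_one_iff hJ hi
    rw [hw, maxAddress_of_isPos _ hi]
    refine ⟨by exact_mod_cast h1, ?_⟩
    have h3 : i ∈ posCompl b I ↔ i ∉ I := ⟨fun h ↦ h.2, fun h ↦ ⟨hi, h⟩⟩
    rw [h3] at h2
    by_cases hiI : i ∈ I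
    · have : minParts P (posCompl b I) i ≠ 1 := fun h ↦ h2.1 h hiI
      simp only [hiI, true_iff]
      omega
    · have := h2.2 hiI
      simp only [hiI, false_iff]
      omega
  have hterm : ∀ w ∈ signType b I, ∀ i, max 0 (address b w i - posInd b i) ≤
      max 0 (maxAddress b (posCompl b I) i - posInd b i) := by
    intro w hw i
    have hK := isAddress_address b w
    rw [mem_signType_iff b hI.isPos] at hw
    by_cases hi : b.IsPos i
    · have := hK.le_maxAddress hJ (fun j hj ↦ by
        by_contra! h; exact hj.2 ((hw j hj.1).2.2 (by omega))) hi
      omega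
    · have h1 := (hw _ ((isPos_opp_iff b i).2 hi)).1
      rw [hK.opp] at h1
      rw [posInd_of_not_isPos hi]
      omega
  have hle : ∀ w ∈ signType b I, excess b (address b w) ≤
      excess b (maxAddress b (posCompl b I)) :=
    fun w hw ↦ Finset.sum_le_sum fun i _ ↦ hterm w hw i
  constructor
  · rintro ⟨hw, hwmax⟩
    obtain ⟨w₀, hw₀⟩ := hmax.exists_address_eq hθ
    have h1 : (length b θ w₀ : ℤ) ≤ length b θ w := by exact_mod_cast hwmax w₀ (hsupp w₀ hw₀)
    rw [length_eq_excess hθ, length_eq_excess hθ, hw₀] at h1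
    -- Equal sums of termwise ordered terms agree termwise. On positive roots both addresses are at
    -- least 1, so the truncation at 0 loses nothing.
    have h2 := (Finset.sum_eq_sum_iff_of_le fun i _ ↦ hterm w hw i).1 (le_antisymm (hle w hw) h1)
    have hw' := (mem_signType_iff b hI.isPos w).1 hw
    have hpos : ∀ i, b.IsPos i → address b w i = maxAddress b (posCompl b I) i := by
      intro i hi
      have h3 := h2 i (Finset.mem_univ i)
      have h4 := (hw' i hi).1
      have h5 := one_le_minParts hJ hi
      rw [posInd_of_isPos hi, maxAddress_of_isPos _ hi] at h3
      rw [maxAddress_of_isPos _ hi]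
      omega
    ext i
    by_cases hi : b.IsPos i
    · exact hpos i hi
    · have h3 := hpos _ ((isPos_opp_iff b i).2 hi)
      rw [(isAddress_address b w).opp, hmax.opp] at h3
      omega
  · intro hw
    refine ⟨hsupp w hw, fun w' hw' ↦ ?_⟩
    have := hle w' hw'
    rw [← hw, ← length_eq_excess hθ, ← length_eq_excess hθ] at this
    exact_mod_cast this

end Ideals

/-! ### Translation parts and the simplex -/

section Bijection

variable {ι M N : Type*} [AddCommGroup M] [Module ℝ M] [AddCommGroup N] [Module ℝ N]
  {P : RootPairing ι ℝ M N} (b : P.Base) [Finite ι] [P.IsCrystallographic] [P.IsReduced]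
  [P.IsRootSystem] [P.IsIrreducible] {θ : ι}

lemma mem_support_of_height_eq_one {i : ι} (h : b.height i = 1) : i ∈ b.support := by
  have hi : b.IsPos i := by rw [Base.isPos_iff]; omega
  have key : 0 < b.height i ∧ (b.height i = 1 → i ∈ b.support) := by
    refine hi.induction_on_add
      (p := fun i ↦ 0 < b.height i ∧ (b.height i = 1 → i ∈ b.support)) ?_ ?_
    · exact fun i hi ↦ ⟨Base.isPos_of_mem_support hi, fun _ ↦ hi⟩
    · rintro i j k hk ⟨h1, -⟩ hj
      have h2 := b.height_add hk
      rw [Base.height_one_of_mem_support hj] at h2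
      exact ⟨by omega, fun h3 ↦ by omega⟩
  exact key.2 h

/-- Here `a = 0` and `c = h - 1`. Only `θ` has height `h - 1`, and the roots of height -1 are the
negatives of the simple roots. -/
lemma latticePoints_coxeterNumber_sub_one {b : P.Base} (hθ : IsHighestRoot b θ) :
    latticePoints b (coxeterNumber b θ) (coxeterNumber b θ - 1) =
      {l : CorootLattice P | pair P θ l ≤ 0 ∧ ∀ i ∈ b.support, -pair P i l ≤ 1} := by
  have hpos : 0 < b.height θ := hθ.isPos
  have h1 : (coxeterNumber b θ - 1) % coxeterNumber b θ = b.height θ := by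
    rw [coxeterNumber, add_sub_cancel_right]
    exact Int.emod_eq_of_lt (by omega) (by omega)
  have h2 : (coxeterNumber b θ - 1) / coxeterNumber b θ = 0 := by
    rw [coxeterNumber, add_sub_cancel_right]
    exact Int.ediv_eq_zero_of_lt (by omega) (by omega)
  ext l
  simp only [latticePoints, h1, h2, Set.mem_ofPred_eq]
  have h3 : b.height θ - coxeterNumber b θ = -1 := by rw [coxeterNumber]; ring
  rw [h3]
  refine ⟨fun ⟨h, h'⟩ ↦ ⟨h θ rfl, fun i hi ↦ ?_⟩, fun ⟨h, h'⟩ ↦ ⟨fun i hi ↦ ?_, fun i hi ↦ ?_⟩⟩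
  · have := h' (P.reflectionPerm i i) (by rw [height_opp, Base.height_one_of_mem_support hi])
    rw [pair_opp] at this
    omega
  · rwa [hθ.eq_of_height_eq hi]
  · have := h' (P.reflectionPerm i i)
      (mem_support_of_height_eq_one b (by rw [height_opp, hi, neg_neg]))
    rw [pair_opp] at this
    omega

/-- By `address_perm`, the right-hand side bounds the address of any `x τ_l` by 1 at the images
under `x` of the simple affine roots; this is the form in which the simplex is used. -/
lemma forall_isSimpleAffine_iff {b : P.Base} (hθ : IsHighestRoot b θ) (l : CorootLattice P) :
    (pair P θ l ≤ 0 ∧ ∀ i ∈ b.support, -pair P i l ≤ 1) ↔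
      ∀ g, IsSimpleAffine b θ g → posInd b g + pair P g l ≤ 1 := by
  constructor
  · rintro ⟨h, h'⟩ g (rfl | hg)
    · rw [posInd_of_isPos hθ.isPos]; omega
    · have := h' _ hg
      have h0 := posInd_opp b g
      rw [posInd_of_isPos (Base.isPos_of_mem_support hg)] at h0
      rw [pair_opp] at this
      omega
  · intro h
    refine ⟨?_, fun i hi ↦ ?_⟩
    · have := h θ (Or.inl rfl)
      rw [posInd_of_isPos hθ.isPos] at this
      omega
    · have := h (P.reflectionPerm i i) (Or.inr (by rwa [opp_opp]))
      rw [posInd_opp, posInd_of_isPos (Base.isPos_of_mem_support hi), pair_opp] at this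
      omega

lemma address_perm (w : AffineWeylGroup P) (i : ι) :
    address b w (P.weylGroupToPerm (finPart w) i) = posInd b i + pair P i (transPart w) :=
  thrAct_perm w _ i

/-- A simple affine root is not a sum of two positive affine roots. -/
lemma IsSimpleAffine.posInd_lt_add {b : P.Base} (hθ : IsHighestRoot b θ) {g : ι}
    (hg : IsSimpleAffine b θ g) {i j : ι} (h : P.root g = P.root i + P.root j) :
    posInd b g < posInd b i + posInd b j := by
  rcases hg with rfl | hg
  · have hi : b.IsPos i := by
      by_contra hi
      exact hθ.add_ne_root _ ((isPos_opp_iff b i).2 hi) j (by rw [root_opp, h]; abel)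
    have hj : b.IsPos j := by
      by_contra hj
      exact hθ.add_ne_root _ ((isPos_opp_iff b j).2 hj) i (by rw [root_opp, h]; abel)
    rw [posInd_of_isPos hi, posInd_of_isPos hj, posInd_of_isPos hθ.isPos]
    norm_num
  · have h1 := Base.height_one_of_mem_support hg
    have h2 := b.height_add h
    have h3 := b.height_ne_zero i
    have h4 := b.height_ne_zero j
    rw [height_opp] at h1
    unfold posInd
    simp only [Base.isPos_iff]
    split_ifs <;> omega

/-- The translation part of a maximal element lies in the simplex. -/
lemma posInd_add_pair_le_one {b : P.Base} (hθ : IsHighestRoot b θ) {I : Set ι}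
    (hI : IsStrictlyPositiveIdeal b I) {w : AffineWeylGroup P}
    (hw : address b w = maxAddress b (posCompl b I)) {g : ι} (hg : IsSimpleAffine b θ g) :
    posInd b g + pair P g (transPart w) ≤ 1 := by
  cases nonempty_fintype ι
  have hJ := hI.support_subset
  have hK := isAddress_address b w
  have hJ1 : ∀ j ∈ posCompl b I, address b w j = 1 := by
    intro j hj
    rw [hw, maxAddress_of_isPos _ hj.1, (minParts_eq_one_iff hJ hj.1).2 hj]
    rfl
  rw [← address_perm]
  set β := P.weylGroupToPerm (finPart w) g with hβ
  by_contra! hlt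
  have hβp : b.IsPos β := by
    by_contra hn
    have := one_le_minParts hJ ((isPos_opp_iff b β).2 hn)
    rw [hw, maxAddress_of_not_isPos _ hn] at hlt
    omega
  -- The address of `β` is the size of a shortest decomposition. Removing a suitable `γ`, of address
  -- 1, leaves a root `k` of address at most the number of remaining summands, so the addresses of
  -- `γ` and `k` add up to at most that of `β`.
  obtain ⟨s, hcard, hs, hsum⟩ := exists_card_eq_minParts hJ hβp
  have hcard' : (s.card : ℤ) = address b w β := by
    rw [hw, maxAddress_of_isPos _ hβp, hcard]
  obtain ⟨γ, hγ, hpos⟩ := exists_mem_rootForm_pos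
    (Submodule.subset_span (Set.mem_range_self β)) (P.ne_zero β) hsum
  have hγ1 := hJ1 γ (hs γ hγ)
  have hne : β ≠ γ := fun e ↦ by rw [← e] at hγ1; omega
  rw [rootForm_comm] at hpos
  obtain ⟨k, hk⟩ := exists_root_eq_sub hne hpos
  obtain ⟨t, rfl⟩ := Multiset.exists_cons_of_mem hγ
  rw [Multiset.map_cons, Multiset.sum_cons] at hsum
  have hkle := hK.le_card (fun j hj ↦ (hJ1 j hj).le) (s := t)
    (fun l hl ↦ hs l (Multiset.mem_cons_of_mem hl)) (i := k) (by rw [hk, ← hsum]; abel)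
  rw [Multiset.card_cons] at hcard'
  push_cast at hcard'
  have hsumle : address b w γ + address b w k ≤ address b w β := by omega
  -- Pulled back by the finite part, addresses become `posInd` plus a linear term. The linear terms
  -- cancel and leave `posInd g₁ + posInd g₂ ≤ posInd g`, impossible for a simple affine root.
  obtain ⟨g₁, rfl⟩ := exists_perm_eq (finPart w) γ
  obtain ⟨g₂, rfl⟩ := exists_perm_eq (finPart w) k
  have hroot : P.root g = P.root g₁ + P.root g₂ := by
    have : P.root β = P.root (P.weylGroupToPerm (finPart w) g₁) +
        P.root (P.weylGroupToPerm (finPart w) g₂) := by rw [hk]; abel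
    have h2 := root_weylGroupToPerm_add (finPart w)⁻¹ this
    have h3 : ∀ i, P.weylGroupToPerm (finPart w)⁻¹ (P.weylGroupToPerm (finPart w) i) = i := by
      intro i
      rw [map_inv]
      exact Equiv.symm_apply_apply _ _
    rwa [hβ, h3, h3, h3] at h2
  have h1 := hg.posInd_lt_add hθ hroot
  have h2 := pair_add_left hroot (transPart w)
  rw [hβ, address_perm, address_perm, address_perm] at hsumle
  omega

/-- An alcove is dominant if its address is at least `1` on the positive roots. -/
lemma isPos_perm_iff {w : AffineWeylGroup P} (h : ∀ i, b.IsPos i → 1 ≤ address b w i) (i : ι) :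
    b.IsPos (P.weylGroupToPerm (finPart w) i) ↔ 1 ≤ posInd b i + pair P i (transPart w) := by
  rw [← address_perm]
  refine ⟨h _, fun h1 ↦ ?_⟩
  by_contra hn
  have := h _ ((isPos_opp_iff b _).2 hn)
  rw [(isAddress_address b w).opp] at this
  omega

/-- A dominant alcove is determined by its translation part. -/
lemma eq_of_transPart_eq {w w' : AffineWeylGroup P} (h : ∀ i, b.IsPos i → 1 ≤ address b w i)
    (h' : ∀ i, b.IsPos i → 1 ≤ address b w' i) (ht : transPart w = transPart w') : w = w' := by
  refine affineWeylGroup_ext ?_ ht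
  have hone : finPart w' * (finPart w)⁻¹ = 1 := by
    refine eq_one_of_forall_isPos b fun i hi ↦ ?_
    obtain ⟨j, rfl⟩ := exists_perm_eq (finPart w) i
    -- Which roots the finite part makes positive depends only on the translation part.
    rw [isPos_perm_iff b h, ht, ← isPos_perm_iff b h'] at hi
    rw [← Equiv.Perm.mul_apply, ← map_mul, inv_mul_cancel_right]
    exact hi
  exact (mul_inv_eq_one.1 hone).symm

/-- The roots with `K ≥ 1` form a positive system of the finite root system. Realising it as an
address produces the Weyl group element that makes an alcove dominant. -/
lemma IsAddress.indicator {K : ι → ℤ} (hK : IsAddress P K) :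
    IsAddress P (fun i ↦ if 1 ≤ K i then 1 else 0) where
  opp i := by
    have := hK.opp i
    split_ifs <;> omega
  add_le i j k hk := by
    have := hK.add_le i j k hk
    split_ifs <;> omega

/-- Every coroot lattice element is the translation part of a dominant alcove. -/
lemma exists_dominant {b : P.Base} (hθ : IsHighestRoot b θ) (l : CorootLattice P) :
    ∃ w : AffineWeylGroup P, transPart w = l ∧ ∀ i, b.IsPos i → 1 ≤ address b w i := by
  have h01 : ∀ i, posInd b i = 0 ∨ posInd b i = 1 := by
    intro i; unfold posInd; split_ifs <;> simp
  have hf : IsAddress P (fun i ↦ posInd b i + pair P i l) := by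
    have h := isAddress_address b (ofWeyl P 1 * tau P l)
    have e : address b (ofWeyl P 1 * tau P l) = fun i ↦ posInd b i + pair P i l := by
      ext i
      have := address_perm b (ofWeyl P 1 * tau P l) i
      rwa [finPart_ofWeyl_mul_tau, transPart_ofWeyl_mul_tau, map_one] at this
    rwa [e] at h
  obtain ⟨y, hy⟩ := hf.indicator.exists_address_eq hθ
  have hy' : ∀ i, (if 1 ≤ posInd b (P.weylGroupToPerm (finPart y) i) +
      pair P (P.weylGroupToPerm (finPart y) i) l then (1 : ℤ) else 0) =
      posInd b i + pair P i (transPart y) := fun i ↦ by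
    rw [← address_perm, hy]
  -- An address with values 0 and 1 has zero translation part. So the finite part of `y` carries the
  -- positive roots to those where the address of `τ_l` is at least 1, and its inverse times `τ_l`
  -- is dominant.
  have hμ : transPart y = 0 := by
    refine eq_zero_of_forall_pair_le_one fun i ↦ ?_
    have h1 := hy' i
    have h2 := h01 i
    split_ifs at h1 <;> omega
  refine ⟨ofWeyl P (finPart y)⁻¹ * tau P l, transPart_ofWeyl_mul_tau _ _ _, fun i hi ↦ ?_⟩
  obtain ⟨j, rfl⟩ := exists_perm_eq (finPart y)⁻¹ i
  obtain ⟨i, rfl⟩ := exists_perm_eq (finPart y) j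
  have h1 := address_perm b (ofWeyl P (finPart y)⁻¹ * tau P l) (P.weylGroupToPerm (finPart y) i)
  rw [finPart_ofWeyl_mul_tau, transPart_ofWeyl_mul_tau] at h1
  rw [h1]
  have h2 : P.weylGroupToPerm (finPart y)⁻¹ (P.weylGroupToPerm (finPart y) i) = i := by
    rw [map_inv]
    exact Equiv.symm_apply_apply _ _
  rw [h2] at hi
  have h3 := hy' i
  rw [hμ, pair_zero_right, posInd_of_isPos hi] at h3
  split_ifs at h3 with h4
  · exact h4
  · omega

/-- The support of a dominant alcove is an ideal. -/
lemma isIdeal_supp {w : AffineWeylGroup P} (h : ∀ i, b.IsPos i → 1 ≤ address b w i) :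
    IsIdeal b (supp b w) where
  isPos i hi := by
    rw [mem_supp_iff] at hi
    by_contra hn
    have := h _ ((isPos_opp_iff b i).2 hn)
    rw [(isAddress_address b w).opp] at this
    rw [posInd_of_not_isPos hn] at hi
    omega
  add_mem i hi j k hj hk hijk := by
    rw [mem_supp_iff] at hi ⊢
    have h1 := (isAddress_address b w).le_add hijk
    have h2 := h j hj
    have hip : 2 ≤ address b w i := by
      by_cases hip : b.IsPos i
      · rw [posInd_of_isPos hip] at hi; omega
      · have := h _ ((isPos_opp_iff b i).2 hip)
        rw [(isAddress_address b w).opp] at this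
        rw [posInd_of_not_isPos hip] at hi
        omega
    rw [posInd_of_isPos hk]
    omega

/-- If the translation part of a dominant alcove lies in the simplex, then the alcove lies
in a bounded region. -/
lemma address_le_one_of_mem_support {b : P.Base} (hθ : IsHighestRoot b θ)
    {w : AffineWeylGroup P} (h : ∀ i, b.IsPos i → 1 ≤ address b w i)
    (hw : ∀ g, IsSimpleAffine b θ g → posInd b g + pair P g (transPart w) ≤ 1)
    {j : ι} (hj : j ∈ b.support) : address b w j ≤ 1 := by
  classical
  by_contra! hlt
  have hK := isAddress_address b w
  let c := coeff b ⟨j, hj⟩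
  have hc0 : ∀ i ∈ b.support, c (P.root i) ≠ 0 → i = j := by
    intro i hi hne
    by_contra hij
    exact hne (by simp [c, coeff_root_support b ⟨j, hj⟩ hi, hij])
  -- If a simple root `j` has address at least 2, then so does every positive root involving `j`.
  have h2 : ∀ i, b.IsPos i → c (P.root i) ≠ 0 → 2 ≤ address b w i := by
    intro i hi
    suffices b.IsPos i ∧ (c (P.root i) ≠ 0 → 2 ≤ address b w i) from this.2
    refine hi.induction_on_add
      (p := fun i ↦ b.IsPos i ∧ (c (P.root i) ≠ 0 → 2 ≤ address b w i)) ?_ ?_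
    · exact fun i hi ↦ ⟨Base.isPos_of_mem_support hi, fun hne ↦ hc0 i hi hne ▸ hlt⟩
    · rintro i l k hk ⟨hi, hi2⟩ hl
      have hlp := Base.isPos_of_mem_support hl
      refine ⟨hi.add hlp hk, fun hne ↦ ?_⟩
      have h1 := hK.le_add hk
      have h3 := h l hlp
      have h4 := h i hi
      by_cases hci : c (P.root i) = 0
      · rw [hk, map_add, hci, zero_add] at hne
        rw [hc0 l hl hne] at h1
        omega
      · have := hi2 hci
        omega
  have h3 : ∀ g, IsSimpleAffine b θ g →
      c (P.root (P.weylGroupToPerm (finPart w) g)) ≤ 0 := by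
    intro g hg
    have h4 := hw g hg
    rw [← address_perm] at h4
    by_cases hp : b.IsPos (P.weylGroupToPerm (finPart w) g)
    · by_contra! hpos
      have := h2 _ hp hpos.ne'
      omega
    · have := coeff_nonneg b ⟨j, hj⟩ ((isPos_opp_iff b _).2 hp)
      rw [root_opp, map_neg] at this
      change c _ ≤ 0
      linarith
  -- Let `x` be the finite part of `w`. The bound on negative simple roots gives `c ∘ x ≥ 0` on
  -- positive roots, and the bound at `θ`, propagated downwards, gives `c ∘ x ≤ 0`. So `c ∘ x`
  -- vanishes on all roots, although `c` is 1 at `j`.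
  have h4 : ∀ i ∈ b.support, 0 ≤ c (P.root (P.weylGroupToPerm (finPart w) i)) := by
    intro i hi
    have := h3 (P.reflectionPerm i i) (Or.inr (by rwa [opp_opp]))
    rw [weylGroupToPerm_opp, root_opp, map_neg] at this
    linarith
  have h5 : ∀ i, b.IsPos i → 0 ≤ c (P.root (P.weylGroupToPerm (finPart w) i)) := by
    intro i hi
    refine hi.induction_on_add
      (p := fun i ↦ 0 ≤ c (P.root (P.weylGroupToPerm (finPart w) i))) h4 ?_
    intro i l k hk hi hl
    rw [root_weylGroupToPerm_add _ hk, map_add]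
    exact add_nonneg hi (h4 l hl)
  have h6 : ∀ i, b.IsPos i → c (P.root (P.weylGroupToPerm (finPart w) i)) ≤ 0 := by
    intro i hi
    refine hθ.induction (p := fun i ↦ c (P.root (P.weylGroupToPerm (finPart w) i)) ≤ 0)
      (h3 θ (Or.inl rfl)) ?_ hi
    intro i l k _ hl hk hk0
    rw [root_weylGroupToPerm_add _ hk, map_add] at hk0
    have := h4 l hl
    linarith
  have hj1 : c (P.root j) = 1 := by simp [c, coeff_root_support b ⟨j, hj⟩ hj]
  obtain ⟨i, hi⟩ := exists_perm_eq (finPart w) j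
  by_cases hp : b.IsPos i
  · have := h6 i hp
    rw [hi] at this
    linarith
  · have := h5 _ ((isPos_opp_iff b i).2 hp)
    rw [weylGroupToPerm_opp, hi, root_opp, map_neg] at this
    linarith

/-- A dominant alcove with translation part in the simplex is maximal in its region. -/
lemma address_eq_maxAddress {b : P.Base} (hθ : IsHighestRoot b θ)
    {w : AffineWeylGroup P} (h : ∀ i, b.IsPos i → 1 ≤ address b w i)
    (hw : ∀ g, IsSimpleAffine b θ g → posInd b g + pair P g (transPart w) ≤ 1)
    (hI : IsStrictlyPositiveIdeal b (supp b w)) :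
    address b w = maxAddress b (posCompl b (supp b w)) := by
  have hJ := hI.support_subset
  have hK := isAddress_address b w
  have hmax := isAddress_maxAddress b hJ hI.isLowerRootSet
  have hJ1 : ∀ j, b.IsPos j → address b w j ≤ 1 → j ∈ posCompl b (supp b w) := by
    intro j hj hj1
    refine ⟨hj, fun hjs ↦ ?_⟩
    rw [mem_supp_iff, posInd_of_isPos hj] at hjs
    omega
  have hJ2 : ∀ j ∈ posCompl b (supp b w), address b w j ≤ 1 := by
    rintro j ⟨hj, hjs⟩
    rw [mem_supp_iff, posInd_of_isPos hj] at hjs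
    omega
  have hK' := hmax.act w⁻¹
  set K' := thrAct w⁻¹ (maxAddress b (posCompl b (supp b w))) with hK'def
  have hwK' : thrAct w K' = maxAddress b (posCompl b (supp b w)) := by
    rw [hK'def, ← thrAct_mul, mul_inv_cancel, thrAct_one]
  have key : K' = posInd b := by
    refine hK'.eq_posInd hθ fun g hg ↦ ?_
    have h1 := thrAct_perm w K' g
    have h2 := hw g hg
    have h3 := address_perm b w g
    rw [hwK'] at h1
    rw [← h3] at h2
    set β := P.weylGroupToPerm (finPart w) g
    -- The address of `w` at `β` is at most 1. A positive `β` thus lies outside the support, where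
    -- `maxAddress` is 1; for negative `β`, oddness reverses the pointwise bound by `maxAddress`.
    have h4 : maxAddress b (posCompl b (supp b w)) β ≤ address b w β := by
      by_cases hβ : b.IsPos β
      · rw [maxAddress_of_isPos _ hβ, (minParts_eq_one_iff hJ hβ).2 (hJ1 β hβ h2)]
        exact_mod_cast h β hβ
      · have h5 := (isPos_opp_iff b β).2 hβ
        have h6 := hK.le_maxAddress hJ hJ2 h5
        rw [hmax.opp, hK.opp] at h6
        omega
    omega
  rw [← hwK', key]
  rfl

end Bijection

end AffineWeyl

/-! ### The main theorem -/

theorem mainTheorem3 {ι M N : Type*} [Finite ι] [AddCommGroup M] [Module ℝ M]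
    [AddCommGroup N] [Module ℝ N] (P : RootPairing ι ℝ M N) [P.IsRootSystem]
    [P.IsCrystallographic] [P.IsReduced] [P.IsIrreducible] (b : P.Base)
    (θ : ι) (hθ : AffineWeyl.IsHighestRoot b θ) :
    AffineWeyl.latticePoints b (AffineWeyl.coxeterNumber b θ)
        (AffineWeyl.coxeterNumber b θ - 1) =
      {l : AffineWeyl.CorootLattice P |
        AffineWeyl.pair P θ l ≤ 0 ∧ ∀ i ∈ b.support, -AffineWeyl.pair P i l ≤ 1} ∧
    (∀ I : Set ι, AffineWeyl.IsStrictlyPositiveIdeal b I →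
      ∃! w : AffineWeyl.AffineWeylGroup P, AffineWeyl.IsMaxElement b θ I w) ∧
    ∃ e : {I : Set ι // AffineWeyl.IsStrictlyPositiveIdeal b I} ≃
        AffineWeyl.latticePoints b (AffineWeyl.coxeterNumber b θ)
          (AffineWeyl.coxeterNumber b θ - 1),
      ∀ (I : {I : Set ι // AffineWeyl.IsStrictlyPositiveIdeal b I})
        (w : AffineWeyl.AffineWeylGroup P), AffineWeyl.IsMaxElement b θ I w →
        ∃ x : P.weylGroup, w = AffineWeyl.ofWeyl P x * AffineWeyl.tau P (e I) := by
  have hD := AffineWeyl.latticePoints_coxeterNumber_sub_one hθ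
  have hex : ∀ I : Set ι, AffineWeyl.IsStrictlyPositiveIdeal b I →
      ∃! w : AffineWeyl.AffineWeylGroup P, AffineWeyl.IsMaxElement b θ I w := by
    intro I hI
    obtain ⟨w, hw⟩ := (AffineWeyl.isAddress_maxAddress b hI.support_subset
      hI.isLowerRootSet).exists_address_eq hθ
    refine ⟨w, (AffineWeyl.isMaxElement_iff hθ hI w).2 hw, fun w' hw' ↦ ?_⟩
    replace hw' := (AffineWeyl.isMaxElement_iff hθ hI w').1 hw'
    exact AffineWeyl.address_injective b (hw'.trans hw.symm)
  refine ⟨hD, hex, ?_⟩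
  choose m hm hm' using hex
  have hdom : ∀ I hI, ∀ i, b.IsPos i → 1 ≤ AffineWeyl.address b (m I hI) i := fun I hI i hi ↦
    ((AffineWeyl.mem_signType_iff b hI.isPos _).1 (hm I hI).1 i hi).1
  have hmem : ∀ I hI, AffineWeyl.transPart (m I hI) ∈
      AffineWeyl.latticePoints b (AffineWeyl.coxeterNumber b θ)
        (AffineWeyl.coxeterNumber b θ - 1) := by
    intro I hI
    rw [hD]
    exact (AffineWeyl.forall_isSimpleAffine_iff hθ _).2 fun g hg ↦
      AffineWeyl.posInd_add_pair_le_one hθ hI ((AffineWeyl.isMaxElement_iff hθ hI _).1 (hm I hI)) hg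
  let f : {I : Set ι // AffineWeyl.IsStrictlyPositiveIdeal b I} →
      AffineWeyl.latticePoints b (AffineWeyl.coxeterNumber b θ)
        (AffineWeyl.coxeterNumber b θ - 1) :=
    fun I ↦ ⟨AffineWeyl.transPart (m I.1 I.2), hmem I.1 I.2⟩
  have hf : Function.Bijective f := by
    constructor
    -- Equal translation parts give equal dominant elements, and the support recovers the ideal.
    · rintro ⟨I, hI⟩ ⟨I', hI'⟩ h
      have h1 := AffineWeyl.eq_of_transPart_eq b (hdom I hI) (hdom I' hI') (congrArg Subtype.val h)
      have h2 : AffineWeyl.supp b (m I hI) = I := (hm I hI).1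
      have h3 : AffineWeyl.supp b (m I' hI') = I' := (hm I' hI').1
      exact Subtype.ext (h2.symm.trans ((congrArg _ h1).trans h3))
    · rintro ⟨l, hl⟩
      obtain ⟨w, rfl, hw⟩ := AffineWeyl.exists_dominant hθ l
      rw [hD] at hl
      replace hl := (AffineWeyl.forall_isSimpleAffine_iff hθ _).1 hl
      have hI : AffineWeyl.IsStrictlyPositiveIdeal b (AffineWeyl.supp b w) :=
        { AffineWeyl.isIdeal_supp b hw with
          disjoint := Set.disjoint_left.2 fun j hj hjs ↦ by
            have := AffineWeyl.address_le_one_of_mem_support hθ hw hl hjs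
            rw [AffineWeyl.mem_supp_iff, AffineWeyl.posInd_of_isPos
              (RootPairing.Base.isPos_of_mem_support hjs)] at hj
            omega }
      refine ⟨⟨AffineWeyl.supp b w, hI⟩, Subtype.ext ?_⟩
      have := hm' _ hI w ((AffineWeyl.isMaxElement_iff hθ hI w).2
        (AffineWeyl.address_eq_maxAddress hθ hw hl hI))
      exact congrArg AffineWeyl.transPart this.symm
  refine ⟨Equiv.ofBijective f hf, fun I w hw ↦ ⟨AffineWeyl.finPart w, ?_⟩⟩
  have := hm' I.1 I.2 w hw
  subst this
  exact AffineWeyl.eq_ofWeyl_mul_tau _
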